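/- **Setting.** Let $\mathbf X\subset\mathbb R^d$ be compact, $P$ a probability measure carried by $\mathbf X$, and $\mathbb K$ a continuous positive semi-definite kernel on $\mathbf X\times\mathbf X$ such that $T_{\mathbb K}f(x)=\int \mathbb K(x,y)f(y)\,dP(y)$ is one-to-one on $L^2(P)$. Let $\lambda_1\ge\lambda_2\ge\cdots$ be the infinite list of all its eigenvalues (with multiplicity) and $\varphi_1,\varphi_2,\dots$ corresponding orthonormal eigenfunctions, with $|\varphi_k(x)|\le M k^{a/2}$ for all $k\ge1$, $x\in\mathbf X$, for some $a\ge 0$ and $M$. Put $a_k(f)=\langle f,\varphi_k\rangle_{L^2(P)}$ and $\mathcal H=\{f\in L^2(P):\|f\|_{\mathcal H}^2=\sum_k a_k(f)^2/\lambda_k<\infty\}$. Let $\rho\ll P$ be a probability measure with $d\rho/dP\le D$, let $X_1,\dots,X_n$ be i.i.d. of law $\rho$, and let $Y_i=f^*(X_i)+\varepsilon_i$ with $f^*\in\mathcal H$, $\|f^*\|_{\mathcal H}\le R$, where the $\varepsilon_i$ are i.i.d., centered, of variance $\sigma^2>0$ and independent of the $X_i$. For $1\le N\le n$ and $\lambda>0$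 let $A_N=[\frac1n\mathbb K(X_i,X_j)]_{i\le n,\,j\le N}$, and let the TKRR estimator be $$\widehat f_{N,\lambda}(x)=\sum_{j=1}^N\widehat\omega_j\,\tfrac1n\mathbb K(X_j,x),\qquad \widehat\omega=(A_N^TA_N+\lambda I_N)^{-1}A_N^TY .$$ Consider the following conditions on the sample $X=(X_1,\dots,X_n)$. Condition $\mathbf H_2$: the $n\times N$ matrix $[\varphi_j(X_i)]$ has full rank. Condition $\mathbf H_3$: there are $\widetilde\omega,\omega'\in\mathbb R^N$ with $\frac1n\sum_j\widetilde\omega_j^2\le1$ and $\frac1n\sum_j\omega_j'^2\le 1$ such that $\sum_j\widetilde\omega_j\frac1n\mathbb K(X_j,\cdot)$ is a best $L^2(P)$-approximation of $f^*$ from $\mathrm{span}\{\mathbb K(X_j,\cdot):j\le N\}$, and $\sum_{k\le N}a_k(f^*)\varphi_k=\sum_j\omega'_j\frac1n\mathbb K_N(X_j,\cdot)$ on $\mathbf X$, where $\mathbb K_N(x,y)=\sum_{m\le N}\lambda_m\varphi_m(x)\varphi_m(y)$. Let $G\subseteq(\mathbb R^d)^n$ be a measurable set such that almost surely $\mathbf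 H_2$ and $\mathbf H_3$ hold when $X\in G$ (if they hold almost surely one may take $G=(\mathbb R^d)^n$, and the indicator below is $1$). Let $$\mathcal R=\mathbb E\Big[\mathbf 1_{\{X\in G\}}\,\frac1n\sum_{i=1}^n\big(\widehat f_{N,\lambda}(X_i)-f^*(X_i)\big)^2\Big],$$ and let $0<\lambda\le A\,\sigma^2N/n$, where $A$ is a constant. **Exponential decay.** There is a constant $C$, depending only on $\mathbf X,P,\mathbb K$, the chosen eigenfunctions and $a,M,D,R,A,c$, such that whenever $b>0$, $N_b\ge1$ and $\lambda_k\le c\,e^{-bk}$ for all $k\ge N_b$, and $N=\max\big(N_b,\lceil\frac1b\log\frac n{\sigma^2}\rceil\big)\le n$, $$\mathcal R\le C\,\sigma^2\max\Big(\frac{N_b}{n},\frac1{b\,n}\log\frac n{\sigma^2}\Big).$$ **Polynomial decay.** Let $\gamma=\min(1,2-a)$. For each $s>a$ there is a constant $C$, depending only on the same data and $s$, such that whenever $N_s\ge1$ and $\lambda_k\le c\,k^{-2s}$ for all $k\ge N_s$, and $N=\max\big(N_s,\lceil(n/\sigma^2)^{1/(2s+\gamma)}\rceil\big)\le n$, $$\mathcal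 R\le C\max\Big(\sigma^2\frac{N_s}{n},\Big(\frac n{\sigma^2}\Big)^{-\frac{2s+\gamma-1}{2s+\gamma}}\Big).$$ -/

import Mathlib

open MeasureTheory
open scoped ENNReal NNReal Matrix

noncomputable section

namespace TKRR

variable {d : ℕ}

/-- The ambient Euclidean space `ℝ^d`. -/
abbrev E (d : ℕ) : Type := EuclideanSpace ℝ (Fin d)

/-- A (real) Mercer kernel on `S`: continuous on `S × S` and positive semi-definite on `S`, that is
every finite Gram matrix is symmetric positive semi-definite. -/
structure IsMercerKernel (S : Set (E d)) (K : E d → E d → ℝ) : Prop where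
  continuousOn : ContinuousOn (fun p : E d × E d => K p.1 p.2) (S ×ˢ S)
  posSemidef : ∀ (m : ℕ) (x : Fin m → E d), (∀ i, x i ∈ S) →
    (Matrix.of fun i j => K (x i) (x j)).PosSemidef

/-- The kernel integral operator `T_K f (x) = ∫ K(x,y) f(y) dP(y)`. -/
def kernelOp (P : Measure (E d)) (K : E d → E d → ℝ) (f : E d → ℝ) (x : E d) : ℝ :=
  ∫ y, K x y * f y ∂P

/-- Hypothesis `H₀`: the operator `T_K : L²(P) → L²(P)` is one-to-one. -/
def OneToOne (P : Measure (E d)) (K : E d → E d → ℝ) : Prop :=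
  ∀ f : E d → ℝ, MemLp f 2 P → kernelOp P K f =ᵐ[P] 0 → f =ᵐ[P] 0

/-- `lam 0 ≥ lam 1 ≥ …` is the list of all eigenvalues of `T_K` on `L²(P)`, with multiplicities, in
decreasing order, and `φ 0, φ 1, …` are corresponding orthonormal eigenfunctions (with their
pointwise-defined versions on `S`). Indices start at `0`: the `k`-th eigenvalue, `k ≥ 1`, is
`lam (k - 1)`. The last field says that no eigenfunction is missing from the list. -/
structure IsEigenSystem (S : Set (E d)) (P : Measure (E d)) (K : E d → E d → ℝ)
    (lam : ℕ → ℝ) (φ : ℕ → E d → ℝ) : Prop where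
  memLp : ∀ k, MemLp (φ k) 2 P
  orthonormal : ∀ j k, ∫ x, φ j x * φ k x ∂P = if j = k then 1 else 0
  eigen : ∀ k, ∀ x ∈ S, kernelOp P K (φ k) x = lam k * φ k x
  antitone : Antitone lam
  exhaustive : ∀ (μ : ℝ) (f : E d → ℝ), MemLp f 2 P →
    kernelOp P K f =ᵐ[P] (fun x => μ * f x) → (∀ k, ∫ x, f x * φ k x ∂P = 0) → f =ᵐ[P] 0

/-- The coefficients `a_k(f) = ⟨f, φ_k⟩` in `L²(P)`. -/
def coeff (P : Measure (E d)) (φ : ℕ → E d → ℝ) (f : E d → ℝ) (k : ℕ) : ℝ :=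
  ∫ x, f x * φ k x ∂P

/-- Membership in the RKHS `H = {f ∈ L²(P) : ∑ a_k(f)² / λ_k < ∞}`. -/
def MemRKHS (P : Measure (E d)) (lam : ℕ → ℝ) (φ : ℕ → E d → ℝ) (f : E d → ℝ) : Prop :=
  MemLp f 2 P ∧ Summable fun k => coeff P φ f k ^ 2 / lam k

/-- The squared RKHS norm `‖f‖_H² = ∑ a_k(f)² / λ_k`. -/
def rkhsNormSq (P : Measure (E d)) (lam : ℕ → ℝ) (φ : ℕ → E d → ℝ) (f : E d → ℝ) : ℝ :=
  ∑' k, coeff P φ f k ^ 2 / lam k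

/-- Hypothesis `H₁`: `ρ` is absolutely continuous with respect to `P` and `dρ/dP` is bounded
(by `D`). -/
def BoundedDensity (P ρ : Measure (E d)) (D : ℝ≥0) : Prop :=
  ρ ≪ P ∧ ∀ᵐ x ∂P, ρ.rnDeriv P x ≤ D

/-- `‖u‖_n² = (1/n) ∑ u_i²`, also used with this factor `1/n` for vectors `u` of length `m ≤ n`. -/
def sqNorm (n : ℕ) {m : ℕ} (u : Fin m → ℝ) : ℝ := (1 / (n : ℝ)) * ∑ i, u i ^ 2

/-- The function `∑_{j ≤ N} ω_j (1/n) k(X_j, ·)`, for a kernel `k`. -/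
def kernelSum (k : E d → E d → ℝ) {n N : ℕ} (h : N ≤ n) (x : Fin n → E d) (ω : Fin N → ℝ)
    (z : E d) : ℝ :=
  ∑ j : Fin N, ω j * ((1 / (n : ℝ)) * k (x (Fin.castLE h j)) z)

/-- The projection `π_N f = ∑_{k ≤ N} a_k(f) φ_k`. -/
def projN (P : Measure (E d)) (φ : ℕ → E d → ℝ) (N : ℕ) (f : E d → ℝ) (z : E d) : ℝ :=
  ∑ k ∈ Finset.range N, coeff P φ f k * φ k z

/-- The truncated kernel `K_N(x,y) = ∑_{m ≤ N} λ_m φ_m(x) φ_m(y)`. -/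
def truncKernel (lam : ℕ → ℝ) (φ : ℕ → E d → ℝ) (N : ℕ) (x y : E d) : ℝ :=
  ∑ m ∈ Finset.range N, lam m * φ m x * φ m y

/-- Hypothesis `H₂` at the sample `x`: the `n × N` matrix `[φ_j(X_i)]` has full rank. -/
def FullRank (φ : ℕ → E d → ℝ) {n : ℕ} (N : ℕ) (x : Fin n → E d) : Prop :=
  (Matrix.of fun (i : Fin n) (j : Fin N) => φ j (x i)).rank = N

/-- `ω` is a coefficient vector of `π̃_N f`, the best `L²(P)`-approximation of `f` from the span of
the functions `(1/n) K(X_j, ·)`, `j ≤ N`. -/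
def IsBestApprox (P : Measure (E d)) (K : E d → E d → ℝ) (f : E d → ℝ) {n N : ℕ} (h : N ≤ n)
    (x : Fin n → E d) (ω : Fin N → ℝ) : Prop :=
  ∀ η : Fin N → ℝ,
    ∫ z, (f z - kernelSum K h x ω z) ^ 2 ∂P ≤ ∫ z, (f z - kernelSum K h x η z) ^ 2 ∂P

/-- Hypothesis `H₃` at the sample `x`: the coefficient vectors `ω̃` of
`π̃_N f = ∑ ω̃_j (1/n) K(X_j, ·)` and `ω'` of `π_N f = ∑ ω'_j (1/n) K_N(X_j, ·)` satisfy
`max (‖ω̃‖_n², ‖ω'‖_n²) ≤ 1`. -/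
def BoundedCoeffs (S : Set (E d)) (P : Measure (E d)) (K : E d → E d → ℝ) (lam : ℕ → ℝ)
    (φ : ℕ → E d → ℝ) (f : E d → ℝ) {n N : ℕ} (h : N ≤ n) (x : Fin n → E d) : Prop :=
  ∃ ω ω' : Fin N → ℝ, IsBestApprox P K f h x ω ∧
    (∀ z ∈ S, projN P φ N f z = kernelSum (truncKernel lam φ N) h x ω' z) ∧
    max (sqNorm n ω) (sqNorm n ω') ≤ 1

/-- The law `ν` of the noise: a centered square-integrable probability law of variance `σ²`. -/
structure IsNoiseLaw (ν : Measure ℝ) (σ : ℝ) : Prop where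
  prob : IsProbabilityMeasure ν
  memLp : MemLp (fun t : ℝ => t) 2 ν
  mean : ∫ t, t ∂ν = 0
  variance : ∫ t, t ^ 2 ∂ν = σ ^ 2

/-- The truncated Gram matrix `A_N = [(1/n) K(X_i, X_j)]`, `i ≤ n`, `j ≤ N`. -/
def gram (K : E d → E d → ℝ) {n N : ℕ} (h : N ≤ n) (x : Fin n → E d) :
    Matrix (Fin n) (Fin N) ℝ :=
  Matrix.of fun i j => (1 / (n : ℝ)) * K (x i) (x (Fin.castLE h j))

/-- The coefficients `ω̂ = (A_Nᵀ A_N + α I_N)⁻¹ A_Nᵀ Y` of the estimator, with regularization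
parameter `α`. -/
def tkrrCoeff (K : E d → E d → ℝ) {n N : ℕ} (h : N ≤ n) (α : ℝ) (x : Fin n → E d)
    (Y : Fin n → ℝ) : Fin N → ℝ :=
  ((gram K h x)ᵀ * gram K h x + α • (1 : Matrix (Fin N) (Fin N) ℝ))⁻¹ *ᵥ ((gram K h x)ᵀ *ᵥ Y)

/-- The TKRR estimator `f̂_{N,α} = ∑_{j ≤ N} ω̂_j (1/n) K(X_j, ·)`. -/
def tkrr (K : E d → E d → ℝ) {n N : ℕ} (h : N ≤ n) (α : ℝ) (x : Fin n → E d)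
    (Y : Fin n → ℝ) : E d → ℝ :=
  kernelSum K h x (tkrrCoeff K h α x Y)

/-- The empirical risk `𝔼 [‖(f̂_{N,α}(X_i) - f(X_i))_i‖_n² ; X ∈ G]` of the TKRR estimator in the
model `Y_i = f(X_i) + ε_i`, over the samples in `G`. The `X_i` are i.i.d. of law `ρ`, the `ε_i` are
i.i.d. of law `ν` and independent of the `X_i`. For `G = univ` this is the empirical risk itself. -/
def risk (ρ : Measure (E d)) (ν : Measure ℝ) (K : E d → E d → ℝ) (f : E d → ℝ) {n N : ℕ}
    (h : N ≤ n) (α : ℝ) (G : Set (Fin n → E d)) : ℝ≥0∞ :=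
  ∫⁻ p in Prod.fst ⁻¹' G, ENNReal.ofReal (sqNorm n fun i =>
      tkrr K h α p.1 (fun k => f (p.1 k) + p.2 k) (p.1 i) - f (p.1 i))
    ∂((Measure.pi fun _ : Fin n => ρ).prod (Measure.pi fun _ : Fin n => ν))

/-- For all sampling laws with density bounded by `D`, all noise laws of variance `σ² > 0`, all
regression functions in the ball of radius `R` of the RKHS, all sample sizes `n`, the truncation
order `N = order n σ ≤ n`, all regularization parameters `0 < α ≤ A σ² N / n`, and all measurable
sets `G` of samples (such as `univ`) on which `H₂` and `H₃` hold almost surely, the empirical risk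
over `G` is at most `C * rate n σ`. -/
def RiskBound (S : Set (E d)) (P : Measure (E d)) (K : E d → E d → ℝ) (lam : ℕ → ℝ)
    (φ : ℕ → E d → ℝ) (D : ℝ≥0) (R A : ℝ) (order : ℕ → ℝ → ℕ) (rate : ℕ → ℝ → ℝ) (C : ℝ) : Prop :=
  ∀ (ρ : Measure (E d)), IsProbabilityMeasure ρ → BoundedDensity P ρ D →
  ∀ (ν : Measure ℝ) (σ : ℝ), 0 < σ → IsNoiseLaw ν σ →
  ∀ (f : E d → ℝ), MemRKHS P lam φ f → rkhsNormSq P lam φ f ≤ R ^ 2 →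
  ∀ (n N : ℕ) (h : N ≤ n), N = order n σ →
  ∀ (α : ℝ), 0 < α → α ≤ A * (σ ^ 2 * N / n) →
  ∀ (G : Set (Fin n → E d)), MeasurableSet G →
    (∀ᵐ x ∂(Measure.pi fun _ : Fin n => ρ), x ∈ G →
      FullRank φ N x ∧ BoundedCoeffs S P K lam φ f h x) →
    risk ρ ν K f h α G ≤ ENNReal.ofReal (C * rate n σ)

/-- The truncation order `N = max (N_b, ⌈(1/b) log (n/σ²)⌉)` for exponential decay. -/
def expOrder (b : ℝ) (Nb n : ℕ) (σ : ℝ) : ℕ :=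
  max Nb ⌈1 / b * Real.log (n / σ ^ 2)⌉₊

/-- The rate `σ² max (N_b/n, (1/(b n)) log (n/σ²))`. -/
def expRate (b : ℝ) (Nb n : ℕ) (σ : ℝ) : ℝ :=
  σ ^ 2 * max ((Nb : ℝ) / n) (1 / (b * n) * Real.log (n / σ ^ 2))

/-- The truncation order `N = max (N_s, ⌈(n/σ²)^{1/(2s+γ)}⌉)` for polynomial decay. -/
def polyOrder (s γ : ℝ) (Ns n : ℕ) (σ : ℝ) : ℕ :=
  max Ns ⌈((n : ℝ) / σ ^ 2) ^ (1 / (2 * s + γ))⌉₊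

/-- The rate `max (σ² N_s/n, (n/σ²)^{-(2s+γ-1)/(2s+γ)})`. -/
def polyRate (s γ : ℝ) (Ns n : ℕ) (σ : ℝ) : ℝ :=
  max (σ ^ 2 * (Ns : ℝ) / n) (((n : ℝ) / σ ^ 2) ^ (-((2 * s + γ - 1) / (2 * s + γ))))

end TKRR

end

/-! Given the design, the fitted values are `H Y` with `H = A (AᵀA + α)⁻¹ Aᵀ`, so the error at the
sample is a bias `H f - f` plus the noise term `H ε`.

Noise: its mean square is `σ²/n` times the squared Frobenius norm of `H`, which is at most `N`
(`sum_sq_hatMatrix_le`). This costs `σ² N / n`.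

Bias: ridge regression minimizes a penalized residual, so any competitor `ω` bounds the bias
(`sum_sq_hatMatrix_sub_le`). The competitor is the vector `ω'` of `H₃`, with penalty at most `α`.
Since `K = K_N + (K - K_N)`, its residual is the projection error `π_N f - f` plus `K - K_N` applied
to `ω'`; Cauchy-Schwarz turns the latter into an average of `(K - K_N)(X_j, X_i)²` over pairs
(`sqNorm_bias_le`).

Means: with `κ` a bound of the kernel, the projection error costs `D lam N R²`, where `lam N` is the
first neglected eigenvalue. A pair of distinct points costs `D² κ lam N`, because `∫ (K - K_N)(x,
y)² dP(y) = ∑_{i ≥ N} lam i² φ i(x)² ≤ lam N * K(x, x)`. The `N` diagonal pairs, with weight `1/n²`,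
cost `D κ ∑_{i ≥ N} lam i` each. `risk_le` collects these bounds.

The last two estimates rest on Mercer's theorem on the diagonal, proved here almost everywhere
(`hasSum_diag`). Completeness of the eigenfunctions comes from the spectral theorem for the compact
self-adjoint operator; remainders are nonnegative on the diagonal because their means over small
squares `B × B` are. The decay hypotheses then compare `lam N` and the tail with the rate
(`exp_bounds`, `poly_bounds`). -/

noncomputable section

namespace TKRR

/-! ### Ridge regression: optimality and the Frobenius norm of the hat matrix. -/

section Ridge

variable {n N : ℕ}

/-- The matrix `AᵀA + α I` of the normal equations of ridge regression. -/
def ridgeMatrix (A : Matrix (Fin n) (Fin N) ℝ) (α : ℝ) : Matrix (Fin N) (Fin N) ℝ :=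
  Aᵀ * A + α • (1 : Matrix (Fin N) (Fin N) ℝ)

lemma ridgeMatrix_posDef (A : Matrix (Fin n) (Fin N) ℝ) {α : ℝ} (hα : 0 < α) :
    (ridgeMatrix A α).PosDef := by
  have h1 : (Aᵀ * A).PosSemidef := by
    simpa [Matrix.conjTranspose_eq_transpose_of_trivial] using
      Matrix.posSemidef_conjTranspose_mul_self A
  exact Matrix.PosDef.posSemidef_add h1 (Matrix.PosDef.one.smul hα)

lemma isUnit_det_ridgeMatrix (A : Matrix (Fin n) (Fin N) ℝ) {α : ℝ} (hα : 0 < α) :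
    IsUnit (ridgeMatrix A α).det :=
  (ridgeMatrix_posDef A hα).det_pos.ne'.isUnit

lemma ridgeMatrix_transpose (A : Matrix (Fin n) (Fin N) ℝ) (α : ℝ) :
    (ridgeMatrix A α)ᵀ = ridgeMatrix A α := by
  simp [ridgeMatrix]

/-- The hat matrix `A (AᵀA + α I)⁻¹ Aᵀ` of ridge regression. -/
def hatMatrix (A : Matrix (Fin n) (Fin N) ℝ) (α : ℝ) : Matrix (Fin n) (Fin n) ℝ :=
  A * (ridgeMatrix A α)⁻¹ * Aᵀ

lemma hatMatrix_mulVec (A : Matrix (Fin n) (Fin N) ℝ) (α : ℝ) (y : Fin n → ℝ) :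
    hatMatrix A α *ᵥ y = A *ᵥ ((ridgeMatrix A α)⁻¹ *ᵥ (Aᵀ *ᵥ y)) := by
  simp [hatMatrix, Matrix.mulVec_mulVec, Matrix.mul_assoc]

/-- The fitted values minimize the penalized residual sum of squares. -/
lemma sum_sq_hatMatrix_sub_le (A : Matrix (Fin n) (Fin N) ℝ) {α : ℝ} (hα : 0 < α)
    (y : Fin n → ℝ) (ω : Fin N → ℝ) :
    ∑ i, ((hatMatrix A α *ᵥ y) i - y i) ^ 2 ≤
      ∑ i, ((A *ᵥ ω) i - y i) ^ 2 + α * ∑ j, ω j ^ 2 := by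
  set w : Fin N → ℝ := (ridgeMatrix A α)⁻¹ *ᵥ (Aᵀ *ᵥ y) with hw
  -- The normal equations: the gradient of the penalized objective vanishes at `w`.
  have hnormal : Aᵀ *ᵥ (A *ᵥ w - y) + α • w = 0 := by
    have h : ridgeMatrix A α *ᵥ w = Aᵀ *ᵥ y := by
      rw [hw, Matrix.mulVec_mulVec, Matrix.mul_nonsing_inv _ (isUnit_det_ridgeMatrix A hα),
        Matrix.one_mulVec]
    rw [Matrix.mulVec_sub, ← h, ridgeMatrix, Matrix.add_mulVec, Matrix.smul_mulVec,
      Matrix.one_mulVec, Matrix.mulVec_mulVec]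
    abel
  rw [hatMatrix_mulVec, ← hw]
  set r : Fin n → ℝ := A *ᵥ w - y
  set δ : Fin N → ℝ := ω - w
  have hA : A *ᵥ ω - y = r + A *ᵥ δ := by
    simp only [r, δ, Matrix.mulVec_sub]; abel
  -- The terms linear in `δ` cancel, so moving from `w` to `w + δ` raises the objective by `‖A δ‖² +
  -- α ‖δ‖²`.
  have hcross : r ⬝ᵥ (A *ᵥ δ) + α * (w ⬝ᵥ δ) = 0 := by
    rw [Matrix.dotProduct_mulVec, ← Matrix.mulVec_transpose, ← smul_eq_mul, ← smul_dotProduct,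
      ← add_dotProduct, hnormal, zero_dotProduct]
  have e1 : ∑ i, ((A *ᵥ w) i - y i) ^ 2 = r ⬝ᵥ r := by
    simp [dotProduct, r, sq]
  have e2 : ∑ i, ((A *ᵥ ω) i - y i) ^ 2 = (r + A *ᵥ δ) ⬝ᵥ (r + A *ᵥ δ) := by
    rw [← hA]; simp [dotProduct, sq]
  have e3 : ∑ j, ω j ^ 2 = (w + δ) ⬝ᵥ (w + δ) := by
    simp [dotProduct, δ, sq]
  rw [e1, e2, e3]
  simp only [add_dotProduct, dotProduct_add, dotProduct_comm (A *ᵥ δ) r, dotProduct_comm δ w]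
  have p1 : 0 ≤ (A *ᵥ δ) ⬝ᵥ (A *ᵥ δ) := Finset.sum_nonneg fun i _ => mul_self_nonneg _
  have p2 : 0 ≤ δ ⬝ᵥ δ := Finset.sum_nonneg fun i _ => mul_self_nonneg _
  have p3 : 0 ≤ w ⬝ᵥ w := Finset.sum_nonneg fun i _ => mul_self_nonneg _
  nlinarith [mul_nonneg hα.le p2, mul_nonneg hα.le p3]

lemma trace_transpose_mul_self {m l : ℕ} (B : Matrix (Fin m) (Fin l) ℝ) :
    (Bᵀ * B).trace = ∑ i, ∑ j, B i j ^ 2 := by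
  simp only [Matrix.trace, Matrix.diag, Matrix.mul_apply, Matrix.transpose_apply]
  rw [Finset.sum_comm]
  simp [sq]

/-- The squared Frobenius norm of the hat matrix is at most the number of regressors. -/
lemma sum_sq_hatMatrix_le (A : Matrix (Fin n) (Fin N) ℝ) {α : ℝ} (hα : 0 < α) :
    ∑ i, ∑ k, hatMatrix A α i k ^ 2 ≤ N := by
  set B := ridgeMatrix A α with hB
  set C := B⁻¹ with hC
  have hu := isUnit_det_ridgeMatrix A hα
  have hCt : Cᵀ = C := by
    rw [hC, Matrix.transpose_nonsing_inv, hB, ridgeMatrix_transpose]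
  have hCB : C * B = 1 := Matrix.nonsing_inv_mul _ hu
  have hG : Aᵀ * A = B - α • 1 := by simp [hB, ridgeMatrix]
  have hCG : C * (Aᵀ * A) = 1 - α • C := by
    rw [hG, Matrix.mul_sub, hCB]; simp
  have h1 : ∑ i, ∑ k, hatMatrix A α i k ^ 2 = (C * (Aᵀ * A) * (C * (Aᵀ * A))).trace := by
    rw [← trace_transpose_mul_self, hatMatrix]
    have : (A * C * Aᵀ)ᵀ * (A * C * Aᵀ) = A * (C * (Aᵀ * A) * C * Aᵀ) := by
      simp [Matrix.transpose_mul, hCt, Matrix.mul_assoc]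
    rw [← hB, ← hC, this, Matrix.trace_mul_comm]
    congr 1
    simp [Matrix.mul_assoc]
  have h2 : ((1 - α • C) * (1 - α • C)).trace
      = N - 2 * α * C.trace + α ^ 2 * (C * C).trace := by
    simp [Matrix.mul_sub, Matrix.sub_mul, Matrix.trace_sub]
    ring
  -- Inserted in `h2`, this leaves `N - 2α tr((AC)ᵀ(AC)) - α² tr(C²)`, where both corrections have
  -- the right sign.
  have h3 : C.trace = ((A * C)ᵀ * (A * C)).trace + α * (C * C).trace := by
    have : (A * C)ᵀ * (A * C) = C * (Aᵀ * A) * C := by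
      simp [Matrix.transpose_mul, hCt, Matrix.mul_assoc]
    rw [this, hCG]
    simp [Matrix.sub_mul, Matrix.trace_sub]
  have h4 : 0 ≤ ((A * C)ᵀ * (A * C)).trace := by
    rw [trace_transpose_mul_self]; positivity
  have h5 : 0 ≤ (C * C).trace := by
    nth_rw 1 [← hCt]
    rw [trace_transpose_mul_self]; positivity
  rw [h1, hCG, h2, h3]
  nlinarith [mul_nonneg hα.le h4, mul_nonneg (sq_nonneg α) h5]

end Ridge

end TKRR

namespace TKRR

/-! ### Finite-rank operators are compact. -/

section CompactOperators

variable {H : Type*} [NormedAddCommGroup H] [NormedSpace ℝ H]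

lemma isCompactOperator_finset_sum {ι : Type*} (s : Finset ι) (T : ι → H →L[ℝ] H)
    (h : ∀ i ∈ s, IsCompactOperator (T i)) : IsCompactOperator ⇑(∑ i ∈ s, T i) := by
  have : ∑ i ∈ s, T i ∈ compactOperator (RingHom.id ℝ) H H :=
    Submodule.sum_mem _ h
  exact this

lemma isCompactOperator_smulRight (l : H →L[ℝ] ℝ) (v : H) :
    IsCompactOperator (l.smulRight v) := by
  have h : IsCompactOperator ((1 : ℝ →L[ℝ] ℝ).smulRight v) :=
    isCompactOperator_of_locallyCompactSpace_rng ((1 : ℝ →L[ℝ] ℝ).smulRight v)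
  have h2 := h.comp_clm l
  have e : ⇑(l.smulRight v) = ⇑((1 : ℝ →L[ℝ] ℝ).smulRight v) ∘ l := by
    funext f
    simp
  rw [e]
  exact h2

end CompactOperators

/-! ### The integral operator of a bounded kernel on `L²(P)`. -/

section KernelOperator

variable {d : ℕ} {P : Measure (E d)} [IsProbabilityMeasure P] {k : E d → E d → ℝ} {B : ℝ}

lemma memLp_kernel_right (hk : Measurable (Function.uncurry k)) (hB : ∀ x y, |k x y| ≤ B)
    (x : E d) (p : ℝ≥0∞) : MemLp (k x) p P :=
  MemLp.of_bound (hk.comp measurable_prodMk_left).aestronglyMeasurable B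
    (Filter.Eventually.of_forall fun y => hB x y)

lemma integrable_kernel_mul (hk : Measurable (Function.uncurry k)) (hB : ∀ x y, |k x y| ≤ B)
    {f : E d → ℝ} (hf : MemLp f 2 P) (x : E d) : Integrable (fun y => k x y * f y) P :=
  (memLp_kernel_right hk hB x 2).integrable_mul hf

lemma integral_abs_le_norm (f : Lp ℝ 2 P) : ∫ x, |f x| ∂P ≤ ‖f‖ := by
  have h := eLpNorm_le_eLpNorm_of_exponent_le (p := 1) (q := 2) (μ := P)
    (by norm_num) (Lp.aestronglyMeasurable f)
  rw [Lp.norm_def]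
  have h1 : ∫ x, |f x| ∂P = (eLpNorm f 1 P).toReal := by
    rw [eLpNorm_one_eq_lintegral_enorm, ← integral_norm_eq_lintegral_enorm
      (Lp.aestronglyMeasurable f)]
    simp
  rw [h1]
  exact ENNReal.toReal_mono (Lp.eLpNorm_ne_top f) h

/-- On a probability space the `L¹` norm is at most the `L²` norm. The bound is asked only at one
`x` and for almost every `y`, so that it also applies to the difference of `k x` and `k (s x)` in
the compactness proof. -/
lemma abs_kernelOp_le {f : Lp ℝ 2 P} {x : E d} {b : ℝ}
    (hb : ∀ᵐ y ∂P, |k x y| ≤ b) : |kernelOp P k f x| ≤ b * ‖f‖ := by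
  have hb0 : 0 ≤ b := by
    obtain ⟨y, hy⟩ := hb.exists
    exact (abs_nonneg _).trans hy
  have hfi : Integrable f P := (Lp.memLp f).integrable (by norm_num)
  calc |kernelOp P k f x| ≤ ∫ y, b * |f y| ∂P := by
        rw [← Real.norm_eq_abs]
        refine norm_integral_le_of_norm_le (hfi.abs.const_mul b) ?_
        filter_upwards [hb] with y hy
        rw [Real.norm_eq_abs, abs_mul]
        gcongr
    _ = b * ∫ y, |f y| ∂P := integral_const_mul _ _
    _ ≤ b * ‖f‖ := by gcongr; exact integral_abs_le_norm f

lemma stronglyMeasurable_kernelOp (hk : Measurable (Function.uncurry k)) {f : E d → ℝ}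
    (hf : AEStronglyMeasurable f P) : StronglyMeasurable (kernelOp P k f) := by
  -- Changing `f` on a null set alters the integral at no `x`, so a measurable version gives
  -- measurability everywhere.
  have h : kernelOp P k f = fun x => ∫ y, k x y * hf.mk f y ∂P := by
    funext x
    refine integral_congr_ae ?_
    filter_upwards [hf.ae_eq_mk] with y hy
    rw [hy]
  rw [h]
  refine StronglyMeasurable.integral_prod_right' (f := fun p : E d × E d => k p.1 p.2 * hf.mk f p.2) ?_
  exact hk.stronglyMeasurable.mul (hf.stronglyMeasurable_mk.comp_measurable measurable_snd)

lemma memLp_kernelOp (hk : Measurable (Function.uncurry k)) (hB : ∀ x y, |k x y| ≤ B)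
    (f : Lp ℝ 2 P) : MemLp (kernelOp P k f) 2 P :=
  MemLp.of_bound (stronglyMeasurable_kernelOp hk (Lp.aestronglyMeasurable f)).aestronglyMeasurable
    (B * ‖f‖) (Filter.Eventually.of_forall fun _ =>
      abs_kernelOp_le (Filter.Eventually.of_forall fun _ => hB _ _))

/-- The operator on `L²(P)` of a bounded measurable kernel. -/
def intOp (hk : Measurable (Function.uncurry k)) (hB : ∀ x y, |k x y| ≤ B) :
    Lp ℝ 2 P →L[ℝ] Lp ℝ 2 P :=
  LinearMap.mkContinuous
    { toFun := fun f => (memLp_kernelOp hk hB f).toLp _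
      map_add' := fun f g => by
        rw [← MemLp.toLp_add, MemLp.toLp_eq_toLp_iff]
        refine Filter.Eventually.of_forall fun x => ?_
        rw [Pi.add_apply, kernelOp, kernelOp, kernelOp,
          ← integral_add (integrable_kernel_mul hk hB (Lp.memLp f) x)
          (integrable_kernel_mul hk hB (Lp.memLp g) x)]
        refine integral_congr_ae ?_
        filter_upwards [Lp.coeFn_add f g] with y hy
        rw [hy, Pi.add_apply, mul_add]
      map_smul' := fun c f => by
        rw [RingHom.id_apply, ← MemLp.toLp_const_smul, MemLp.toLp_eq_toLp_iff]
        refine Filter.Eventually.of_forall fun x => ?_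
        rw [Pi.smul_apply, kernelOp, kernelOp, smul_eq_mul, ← integral_const_mul]
        refine integral_congr_ae ?_
        filter_upwards [Lp.coeFn_smul c f] with y hy
        rw [hy, Pi.smul_apply, smul_eq_mul]
        ring } B fun f => by
    have hB0 : 0 ≤ B := (abs_nonneg _).trans (hB 0 0)
    have := Lp.norm_le_of_ae_bound (μ := P) (p := 2) (f := (memLp_kernelOp hk hB f).toLp _)
      (C := B * ‖f‖) (by positivity) (by
        filter_upwards [(memLp_kernelOp hk hB f).coeFn_toLp] with x hx
        rw [hx]
        exact abs_kernelOp_le (Filter.Eventually.of_forall fun _ => hB _ _))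
    rw [measureUnivNNReal, measure_univ, ENNReal.toNNReal_one, NNReal.coe_one, Real.one_rpow,
      one_mul] at this
    exact this

lemma coeFn_intOp (hk : Measurable (Function.uncurry k)) (hB : ∀ x y, |k x y| ≤ B)
    (f : Lp ℝ 2 P) : intOp hk hB f =ᵐ[P] kernelOp P k f :=
  (memLp_kernelOp hk hB f).coeFn_toLp

lemma intOp_isSymmetric (hk : Measurable (Function.uncurry k)) (hB : ∀ x y, |k x y| ≤ B)
    (hs : ∀ x y, k x y = k y x) : (intOp (P := P) hk hB).IsSymmetric := by
  intro f g
  change inner ℝ (intOp hk hB f) g = inner ℝ f (intOp hk hB g)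
  rw [L2.inner_def, L2.inner_def]
  have hfi : Integrable f P := (Lp.memLp f).integrable (by norm_num)
  have hgi : Integrable g P := (Lp.memLp g).integrable (by norm_num)
  have h1 : ∫ x, inner ℝ (intOp hk hB f x) (g x) ∂P = ∫ x, ∫ y, k x y * f y * g x ∂P ∂P := by
    refine integral_congr_ae ?_
    filter_upwards [coeFn_intOp hk hB f] with x hx
    rw [hx, integral_mul_const]
    simp [kernelOp, mul_comm]
  have h2 : ∫ y, inner ℝ (f y) (intOp hk hB g y) ∂P = ∫ y, ∫ x, k x y * f y * g x ∂P ∂P := by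
    refine integral_congr_ae ?_
    filter_upwards [coeFn_intOp hk hB g] with y hy
    rw [hy, kernelOp, real_inner_comm, real_inner_eq_re_inner ℝ]
    simp only [RCLike.inner_apply, conj_trivial, RCLike.re_to_real]
    rw [← integral_const_mul]
    refine integral_congr_ae (Filter.Eventually.of_forall fun x => ?_)
    simp only [hs y x]
    ring
  rw [h1, h2]
  -- Fubini applies because the integrand is a bounded kernel times a product of integrable
  -- functions.
  refine integral_integral_swap ?_
  have h3 : Integrable (fun p : E d × E d => g p.1 * f p.2) (P.prod P) := hgi.mul_prod hfi
  refine (h3.bdd_mul (c := B) hk.aestronglyMeasurable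
    (Filter.Eventually.of_forall fun p => hB p.1 p.2)).congr
    (Filter.Eventually.of_forall fun p => ?_)
  simp only [Function.uncurry]
  ring

/-- A kernel that is approximated uniformly, on a set of full measure, by its composition with
simple functions in the first variable has a compact integral operator. -/
lemma intOp_isCompactOperator (hk : Measurable (Function.uncurry k)) (hB : ∀ x y, |k x y| ≤ B)
    (happ : ∀ ε > 0, ∃ s : SimpleFunc (E d) (E d), ∀ᵐ x ∂P, ∀ᵐ y ∂P, |k x y - k (s x) y| ≤ ε) :
    IsCompactOperator (intOp (P := P) hk hB) := by
  have hmem : intOp (P := P) hk hB ∈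
      closure {T : Lp ℝ 2 P →L[ℝ] Lp ℝ 2 P | IsCompactOperator T} := by
    rw [Metric.mem_closure_iff]
    intro ε hε
    obtain ⟨s, hs⟩ := happ (ε / 2) (by positivity)
    have hind : ∀ p, MemLp ((s ⁻¹' {p}).indicator fun _ => (1 : ℝ)) 2 P := fun p =>
      (memLp_const 1).indicator (s.measurableSet_fiber p)
    let l : E d → Lp ℝ 2 P →L[ℝ] ℝ := fun p =>
      innerSL ℝ ((memLp_kernel_right hk hB p 2).toLp (k p) : Lp ℝ 2 P)
    have hl : ∀ p (f : Lp ℝ 2 P), l p f = kernelOp P k f p := by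
      intro p f
      simp only [l, innerSL_apply_apply, L2.inner_def, kernelOp]
      refine integral_congr_ae ?_
      filter_upwards [(memLp_kernel_right hk hB p 2).coeFn_toLp (μ := P)] with y hy
      rw [hy]
      simp [mul_comm]
    -- The finite-rank approximant evaluates the image of `f` at `s x` instead of `x`; `s` takes
    -- finitely many values.
    let T : Lp ℝ 2 P →L[ℝ] Lp ℝ 2 P := ∑ p ∈ s.range, (l p).smulRight ((hind p).toLp _)
    have hT : ∀ f, T f =ᵐ[P] fun x => kernelOp P k f (s x) := by
      intro f
      have e : T f = ∑ p ∈ s.range, l p f • (hind p).toLp _ := by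
        simp [T]
      rw [e]
      have h1 : ∀ᵐ x ∂P, ∀ p ∈ s.range, (l p f • (hind p).toLp _ : Lp ℝ 2 P) x =
          l p f * (s ⁻¹' {p}).indicator (fun _ => (1 : ℝ)) x := by
        rw [Filter.eventually_all_finset]
        intro p _
        filter_upwards [Lp.coeFn_smul (l p f) ((hind p).toLp _), (hind p).coeFn_toLp] with x h1 h2
        rw [h1, Pi.smul_apply, h2, smul_eq_mul]
      filter_upwards [Lp.coeFn_finsetSum s.range fun p => (l p f • (hind p).toLp _ : Lp ℝ 2 P), h1]
        with x hx h1
      rw [hx, Finset.sum_apply, Finset.sum_congr rfl h1, Finset.sum_eq_single (s x)]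
      · simp [hl]
      · intro p _ hp
        rw [Set.indicator_of_notMem, mul_zero]
        simpa using hp.symm
      · intro h
        exact absurd (s.mem_range_self x) h
    refine ⟨T, isCompactOperator_finset_sum _ _ fun p _ => isCompactOperator_smulRight _ _, ?_⟩
    rw [dist_eq_norm]
    refine lt_of_le_of_lt (b := ε / 2) ?_ (by linarith)
    refine ContinuousLinearMap.opNorm_le_bound _ (by positivity) fun f => ?_
    have := Lp.norm_le_of_ae_bound (μ := P) (p := 2) (f := (intOp (P := P) hk hB - T) f)
      (C := ε / 2 * ‖f‖) (by positivity) ?_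
    · rw [measureUnivNNReal, measure_univ, ENNReal.toNNReal_one, NNReal.coe_one, Real.one_rpow,
        one_mul] at this
      exact this
    rw [sub_apply]
    filter_upwards [Lp.coeFn_sub (intOp hk hB f) (T f), coeFn_intOp hk hB f, hT f, hs]
      with x h1 h2 h3 h4
    rw [h1, Pi.sub_apply, h2, h3]
    have h5 : kernelOp P k f x - kernelOp P k f (s x)
        = kernelOp P (fun x y => k x y - k (s x) y) f x := by
      simp only [kernelOp]
      rw [← integral_sub (integrable_kernel_mul hk hB (Lp.memLp f) x)
        (integrable_kernel_mul hk hB (Lp.memLp f) (s x))]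
      refine integral_congr_ae (Filter.Eventually.of_forall fun y => ?_)
      simp only
      ring
    rw [h5]
    exact abs_kernelOp_le h4
  exact isClosed_setOfPred_isCompactOperator.closure_subset hmem

end KernelOperator

/-! ### Totality of an exhaustive family of eigenvectors. -/

section Completeness

variable {H : Type*} [NormedAddCommGroup H] [InnerProductSpace ℝ H] [CompleteSpace H]

/-- If every eigenvector of a compact self-adjoint operator that is orthogonal to a family of
eigenvectors vanishes, then the family is total. -/
lemma span_orthogonal_eq_bot_of_exhaustive {T : H →L[ℝ] H} (hT : IsCompactOperator T)
    (hs : T.IsSymmetric) {v : ℕ → H} {lam : ℕ → ℝ} (hv : ∀ k, T (v k) = lam k • v k)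
    (hex : ∀ (μ : ℝ) (f : H), T f = μ • f → (∀ k, inner ℝ (v k) f = 0) → f = 0) :
    (Submodule.span ℝ (Set.range v))ᗮ = ⊥ := by
  set V := (Submodule.span ℝ (Set.range v))ᗮ with hV
  have hmem : ∀ f, f ∈ V ↔ ∀ k, inner ℝ (v k) f = 0 := by
    intro f
    rw [hV, Submodule.mem_orthogonal]
    constructor
    · intro h k
      exact h _ (Submodule.subset_span ⟨k, rfl⟩)
    · intro h u hu
      induction hu using Submodule.span_induction with
      | mem x hx => obtain ⟨k, rfl⟩ := hx; exact h k
      | zero => simp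
      | add x y _ _ hx hy => rw [inner_add_left, hx, hy, add_zero]
      | smul c x _ hx => rw [inner_smul_left, hx, mul_zero]
  have hinv : ∀ f ∈ V, T f ∈ V := by
    intro f hf
    rw [hmem] at hf ⊢
    intro k
    have := hs (v k) f
    change inner ℝ (T (v k)) f = inner ℝ (v k) (T f) at this
    rw [← this, hv, inner_smul_left, hf k, mul_zero]
  let T' : V →L[ℝ] V := T.restrict hinv
  have hc : IsCompactOperator T' := hT.restrict' hinv
  have hs' : T'.IsSymmetric := hs.restrict_invariant hinv
  have hno : ∀ (μ : ℝ) (f : V), T' f = μ • f → f = 0 := by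
    intro μ f hf
    refine Subtype.ext (hex μ f ?_ ((hmem _).1 f.2))
    exact congrArg Subtype.val hf
  -- A compact self-adjoint operator all of whose eigenvalues vanish is zero. Every vector of `V` is
  -- then an eigenvector for `0`, and exhaustiveness kills it.
  have h0 : T' = 0 := by
    rw [← ContinuousLinearMap.eq_zero_of_forall_hasEigenvalue_eq_zero hc hs']
    intro μ hμ
    obtain ⟨f, hf⟩ := hμ.exists_hasEigenvector
    exact absurd (hno μ f hf.apply_eq_smul) hf.2
  rw [Submodule.eq_bot_iff]
  intro f hf
  have := hno 0 ⟨f, hf⟩ (by rw [h0]; simp)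
  exact congrArg Subtype.val this

end Completeness

end TKRR

/-! ### Mercer systems: positivity of eigenvalues and of diagonal remainders. -/

namespace TKRR

set_option linter.unusedSectionVars false

variable {d : ℕ}

/-- A bounded measurable symmetric kernel together with a complete orthonormal system of
eigenfunctions with nonzero eigenvalues in decreasing order, and such that almost every point has
neighbours, in a set of positive measure, at which the kernel functions are uniformly close. -/
structure IsMercerSystem (P : Measure (E d)) (k : E d → E d → ℝ) (κ : ℝ) (lam : ℕ → ℝ)
    (e : ℕ → E d → ℝ) : Prop where
  measurable_kernel : Measurable (Function.uncurry k)
  abs_kernel_le : ∀ x y, |k x y| ≤ κ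
  symm : ∀ x y, k x y = k y x
  measurable_eigenfun : ∀ i, Measurable (e i)
  memLp : ∀ i, MemLp (e i) 2 P
  orthonormal : ∀ i j, ∫ x, e i x * e j x ∂P = if i = j then 1 else 0
  eigen : ∀ i x, kernelOp P k (e i) x = lam i * e i x
  antitone : Antitone lam
  lam_ne_zero : ∀ i, lam i ≠ 0
  hasSum_mul : ∀ f g : E d → ℝ, MemLp f 2 P → MemLp g 2 P →
    HasSum (fun i => (∫ x, f x * e i x ∂P) * ∫ x, g x * e i x ∂P) (∫ x, f x * g x ∂P)
  oscillation : ∀ᵐ x ∂P, ∀ ε > 0, ∃ B, MeasurableSet B ∧ 0 < P B ∧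
    ∀ y ∈ B, ∀ z, |k x z - k y z| ≤ ε

/-- The remainder `K - K_N` of the truncated eigenfunction expansion of a kernel. -/
def truncRem (k : E d → E d → ℝ) (lam : ℕ → ℝ) (e : ℕ → E d → ℝ) (N : ℕ) (x y : E d) : ℝ :=
  k x y - truncKernel lam e N x y

namespace IsMercerSystem

variable {P : Measure (E d)} [IsProbabilityMeasure P] {k : E d → E d → ℝ} {κ : ℝ} {lam : ℕ → ℝ}
  {e : ℕ → E d → ℝ} (h : IsMercerSystem P k κ lam e)

include h

lemma bound_nonneg : 0 ≤ κ := (abs_nonneg _).trans (h.abs_kernel_le 0 0)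

lemma memLp_kernel (x : E d) : MemLp (k x) 2 P :=
  memLp_kernel_right h.measurable_kernel h.abs_kernel_le x 2

lemma integral_kernel_mul_eigenfun (i : ℕ) (x : E d) :
    ∫ y, k x y * e i y ∂P = lam i * e i x := h.eigen i x

lemma integrable_eigenfun_sq (i : ℕ) : Integrable (fun x => e i x ^ 2) P :=
  (h.memLp i).integrable_sq

lemma integral_eigenfun_sq (i : ℕ) : ∫ x, e i x ^ 2 ∂P = 1 := by
  simpa [sq] using h.orthonormal i i

lemma hasSum_kernel_sq (x : E d) :
    HasSum (fun i => lam i ^ 2 * e i x ^ 2) (∫ y, k x y ^ 2 ∂P) := by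
  have := h.hasSum_mul _ _ (h.memLp_kernel x) (h.memLp_kernel x)
  simp only [h.integral_kernel_mul_eigenfun] at this
  convert this using 2 <;> ring_nf

lemma integral_kernel_sq_le (x : E d) : ∫ y, k x y ^ 2 ∂P ≤ κ ^ 2 := by
  calc ∫ y, k x y ^ 2 ∂P ≤ ∫ _, κ ^ 2 ∂P := by
        refine integral_mono (h.memLp_kernel x).integrable_sq (integrable_const _) fun y => ?_
        exact sq_le_sq' (abs_le.1 (h.abs_kernel_le x y)).1 (abs_le.1 (h.abs_kernel_le x y)).2
    _ = κ ^ 2 := by simp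

/-- The operator is Hilbert-Schmidt: Parseval for `k x`, integrated over `x`, bounds `∑ lam i ^ 2`
by `κ ^ 2`. -/
lemma tendsto_lam : Filter.Tendsto lam Filter.atTop (nhds 0) := by
  have hs : Summable fun i => lam i ^ 2 := by
    refine summable_of_sum_range_le (c := κ ^ 2) (fun i => sq_nonneg _) fun n => ?_
    have h1 : ∑ i ∈ Finset.range n, lam i ^ 2
        = ∫ x, ∑ i ∈ Finset.range n, lam i ^ 2 * e i x ^ 2 ∂P := by
      rw [integral_finsetSum _ fun i _ => (h.integrable_eigenfun_sq i).const_mul _]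
      refine Finset.sum_congr rfl fun i _ => ?_
      rw [integral_const_mul, h.integral_eigenfun_sq, mul_one]
    rw [h1]
    calc _ ≤ ∫ _, κ ^ 2 ∂P := by
          refine integral_mono (integrable_finsetSum _ fun i _ =>
            (h.integrable_eigenfun_sq i).const_mul _) (integrable_const _) fun x => ?_
          exact (sum_le_hasSum _ (fun i _ => by positivity) (h.hasSum_kernel_sq x)).trans
            (h.integral_kernel_sq_le x)
      _ = κ ^ 2 := by simp
  have h2 := hs.tendsto_atTop_zero
  have h3 := h2.sqrt
  rw [Real.sqrt_zero] at h3
  rw [tendsto_zero_iff_abs_tendsto_zero]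
  simpa [Real.sqrt_sq_eq_abs, Function.comp_def] using h3

/-- A decreasing sequence with limit zero is nonnegative, and zero is excluded. -/
lemma lam_pos (i : ℕ) : 0 < lam i :=
  lt_of_le_of_ne (h.antitone.le_of_tendsto h.tendsto_lam i) (h.lam_ne_zero i).symm

lemma measurable_truncKernel (N : ℕ) : Measurable (Function.uncurry (truncKernel lam e N)) := by
  have he := h.measurable_eigenfun
  unfold truncKernel Function.uncurry
  fun_prop

lemma measurable_truncRem (N : ℕ) : Measurable (Function.uncurry (truncRem k lam e N)) :=
  h.measurable_kernel.sub (h.measurable_truncKernel N)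

lemma memLp_truncKernel (N : ℕ) (x : E d) : MemLp (truncKernel lam e N x) 2 P := by
  unfold truncKernel
  exact memLp_finsetSum _ fun i _ => (h.memLp i).const_mul _

lemma memLp_truncRem (N : ℕ) (x : E d) : MemLp (truncRem k lam e N x) 2 P :=
  (h.memLp_kernel x).sub (h.memLp_truncKernel N x)

lemma integrable_mul_eigenfun {f : E d → ℝ} (hf : MemLp f 2 P) (i : ℕ) :
    Integrable (fun x => f x * e i x) P := hf.integrable_mul (h.memLp i)

/-- The coefficients of a truncated expansion subtracted from `f`. -/
lemma integral_sub_sum_mul {f : E d → ℝ} (hf : MemLp f 2 P) (N : ℕ) (c : ℕ → ℝ) (i : ℕ) :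
    ∫ x, (f x - ∑ m ∈ Finset.range N, c m * e m x) * e i x ∂P
      = ∫ x, f x * e i x ∂P - if i < N then c i else 0 := by
  have h1 : ∀ x, (f x - ∑ m ∈ Finset.range N, c m * e m x) * e i x
      = f x * e i x - ∑ m ∈ Finset.range N, c m * (e m x * e i x) := by
    intro x
    rw [sub_mul, Finset.sum_mul]
    simp only [mul_assoc]
  have h2 : ∀ m, Integrable (fun x => e m x * e i x) P := fun m => h.integrable_mul_eigenfun (h.memLp m) i
  simp only [h1]
  rw [integral_sub (h.integrable_mul_eigenfun hf i)
    (integrable_finsetSum _ fun m _ => (h2 m).const_mul _),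
    integral_finsetSum _ fun m _ => (h2 m).const_mul _]
  congr 1
  simp only [integral_const_mul, h.orthonormal]
  simp [Finset.sum_ite_eq']

/-- Parseval: subtracting the truncated expansion deletes exactly the first `N` coefficients `lam i
* e i x` of `k x`. -/
lemma hasSum_integral_truncRem_sq (N : ℕ) (x : E d) :
    HasSum (fun i => if i < N then 0 else lam i ^ 2 * e i x ^ 2)
      (∫ y, truncRem k lam e N x y ^ 2 ∂P) := by
  have := h.hasSum_mul _ _ (h.memLp_truncRem N x) (h.memLp_truncRem N x)
  have h1 : ∀ i, ∫ y, truncRem k lam e N x y * e i y ∂P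
      = if i < N then 0 else lam i * e i x := by
    intro i
    have := h.integral_sub_sum_mul (h.memLp_kernel x) N (fun m => lam m * e m x) i
    rw [h.integral_kernel_mul_eigenfun] at this
    simp only [truncRem, truncKernel]
    rw [this]
    split_ifs <;> ring
  simp only [h1] at this
  convert this using 2 with i
  · split_ifs <;> ring
  · ring_nf

/-- Spectral expansion of the mean of the kernel over a product set. -/
lemma hasSum_setIntegral_kernel {B : Set (E d)} (hB : MeasurableSet B) :
    HasSum (fun i => lam i * (∫ y in B, e i y ∂P) ^ 2) (∫ y in B, ∫ z in B, k y z ∂P ∂P) := by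
  have hind : MemLp (B.indicator fun _ => (1 : ℝ)) 2 P := (memLp_const 1).indicator hB
  have hT : MemLp (kernelOp P k (B.indicator fun _ => (1 : ℝ))) 2 P := by
    refine MemLp.of_bound (stronglyMeasurable_kernelOp h.measurable_kernel
      hind.aestronglyMeasurable).aestronglyMeasurable κ (Filter.Eventually.of_forall fun x => ?_)
    have := norm_integral_le_of_norm_le_const (μ := P) (C := κ)
      (f := fun y => k x y * B.indicator (fun _ => (1 : ℝ)) y)
      (Filter.Eventually.of_forall fun y => ?_)
    · simpa [kernelOp] using this
    · by_cases hy : y ∈ B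
      · simpa [hy] using h.abs_kernel_le x y
      · simpa [hy] using h.bound_nonneg
  -- Parseval for the image of the indicator of `B` against the indicator itself; no pointwise
  -- expansion of the kernel is needed.
  have key := h.hasSum_mul _ _ hT hind
  have hi : ∀ f : E d → ℝ, ∫ y, f y * B.indicator (fun _ => (1 : ℝ)) y ∂P = ∫ y in B, f y ∂P := by
    intro f
    rw [← integral_indicator hB]
    refine integral_congr_ae (Filter.Eventually.of_forall fun y => ?_)
    by_cases hy : y ∈ B <;> simp [hy]
  have hi' : ∀ f : E d → ℝ, ∫ y, B.indicator (fun _ => (1 : ℝ)) y * f y ∂P = ∫ y in B, f y ∂P := by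
    intro f
    rw [← hi]
    simp only [mul_comm]
  have hk : ∀ x, kernelOp P k (B.indicator fun _ => (1 : ℝ)) x = ∫ z in B, k x z ∂P := fun x => hi _
  have hc : ∀ i, ∫ x, kernelOp P k (B.indicator fun _ => (1 : ℝ)) x * e i x ∂P
      = lam i * ∫ y in B, e i y ∂P := by
    intro i
    simp only [hk]
    calc ∫ x, (∫ z in B, k x z ∂P) * e i x ∂P = ∫ x, ∫ z in B, k x z * e i x ∂P ∂P := by
          simp only [integral_mul_const]
      _ = ∫ z in B, ∫ x, k x z * e i x ∂P ∂P := by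
          refine integral_integral_swap ?_
          have h1 : Integrable (fun p : E d × E d => e i p.1 * (1 : ℝ)) (P.prod (P.restrict B)) :=
            ((h.memLp i).integrable (by norm_num)).mul_prod (integrable_const 1)
          refine (h1.bdd_mul (c := κ) h.measurable_kernel.aestronglyMeasurable
            (Filter.Eventually.of_forall fun p => h.abs_kernel_le p.1 p.2)).congr
            (Filter.Eventually.of_forall fun p => ?_)
          simp [Function.uncurry]
      _ = ∫ z in B, lam i * e i z ∂P := by
          refine integral_congr_ae (Filter.Eventually.of_forall fun z => ?_)
          simp only [h.symm _ z, h.integral_kernel_mul_eigenfun]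
      _ = lam i * ∫ y in B, e i y ∂P := integral_const_mul _ _
  simp only [hc] at key
  simp only [hi', hi, hk] at key
  convert key using 2
  ring

lemma integrable_eigenfun (i : ℕ) : Integrable (e i) P := (h.memLp i).integrable (by norm_num)

lemma setIntegral_truncRem (B : Set (E d)) (N : ℕ) (y : E d) :
    ∫ z in B, truncRem k lam e N y z ∂P
      = ∫ z in B, k y z ∂P - ∑ i ∈ Finset.range N, (lam i * ∫ z in B, e i z ∂P) * e i y := by
  have hei : ∀ i, Integrable (e i) (P.restrict B) := fun i => (h.integrable_eigenfun i).restrict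
  simp only [truncRem, truncKernel]
  rw [integral_sub ((h.memLp_kernel y).integrable (by norm_num)).restrict
    (integrable_finsetSum _ fun i _ => (hei i).const_mul _),
    integral_finsetSum _ fun i _ => (hei i).const_mul _]
  congr 1
  refine Finset.sum_congr rfl fun i _ => ?_
  rw [integral_const_mul]
  ring

lemma integrableOn_setIntegral_kernel (B : Set (E d)) :
    IntegrableOn (fun y => ∫ z in B, k y z ∂P) B P := by
  have : Integrable (Function.uncurry k) ((P.restrict B).prod (P.restrict B)) :=
    Integrable.of_bound h.measurable_kernel.aestronglyMeasurable κ
      (Filter.Eventually.of_forall fun p => h.abs_kernel_le p.1 p.2)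
  exact this.integral_prod_left

lemma integrableOn_setIntegral_truncRem (B : Set (E d)) (N : ℕ) :
    IntegrableOn (fun y => ∫ z in B, truncRem k lam e N y z ∂P) B P := by
  simp only [h.setIntegral_truncRem]
  exact (h.integrableOn_setIntegral_kernel B).sub
    (integrable_finsetSum _ fun i _ => (h.integrable_eigenfun i).restrict.const_mul _)

/-- The integral is the tail, from `N` on, of the series of nonnegative terms `lam i * (∫ y in B, e
i y ∂P) ^ 2`. -/
lemma setIntegral_truncRem_nonneg {B : Set (E d)} (hB : MeasurableSet B) (N : ℕ) :
    0 ≤ ∫ y in B, ∫ z in B, truncRem k lam e N y z ∂P ∂P := by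
  have hs := sum_le_hasSum (Finset.range N)
    (fun i _ => mul_nonneg (h.lam_pos i).le (sq_nonneg _)) (h.hasSum_setIntegral_kernel hB)
  have hei : ∀ i, Integrable (e i) (P.restrict B) := fun i => (h.integrable_eigenfun i).restrict
  simp only [h.setIntegral_truncRem]
  rw [integral_sub (h.integrableOn_setIntegral_kernel B)
      (integrable_finsetSum _ fun i _ => (hei i).const_mul _),
    integral_finsetSum _ fun i _ => (hei i).const_mul _]
  simp only [integral_const_mul]
  rw [sub_nonneg]
  refine le_of_eq_of_le (Finset.sum_congr rfl fun i _ => ?_) hs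
  ring

/-- The eigenvalue equation writes `e i` as `(lam i)⁻¹` times an integral against the kernel, so it
inherits the kernel's oscillation. -/
lemma abs_eigenfun_sub_le {x y : E d} {ε : ℝ} (hxy : ∀ z, |k x z - k y z| ≤ ε) (i : ℕ) :
    |e i x - e i y| ≤ ε * ((lam i)⁻¹ * ∫ z, |e i z| ∂P) := by
  have h1 : lam i * (e i x - e i y) = ∫ z, (k x z - k y z) * e i z ∂P := by
    rw [mul_sub, ← h.integral_kernel_mul_eigenfun, ← h.integral_kernel_mul_eigenfun,
      ← integral_sub (h.integrable_mul_eigenfun (h.memLp_kernel x) i)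
        (h.integrable_mul_eigenfun (h.memLp_kernel y) i)]
    simp only [sub_mul]
  have h2 : |lam i * (e i x - e i y)| ≤ ε * ∫ z, |e i z| ∂P := by
    rw [h1, ← integral_const_mul, ← Real.norm_eq_abs]
    refine norm_integral_le_of_norm_le ((h.integrable_eigenfun i).abs.const_mul ε)
      (Filter.Eventually.of_forall fun z => ?_)
    rw [Real.norm_eq_abs, abs_mul]
    gcongr
    exact hxy z
  rw [abs_mul, abs_of_pos (h.lam_pos i)] at h2
  have h3 := h.lam_pos i
  calc |e i x - e i y| = (lam i)⁻¹ * (lam i * |e i x - e i y|) := by field_simp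
    _ ≤ (lam i)⁻¹ * (ε * ∫ z, |e i z| ∂P) := by gcongr
    _ = _ := by ring

lemma abs_kernel_diag_sub_le {x y z : E d} {ε : ℝ} (hy : ∀ w, |k x w - k y w| ≤ ε)
    (hz : ∀ w, |k x w - k z w| ≤ ε) : |k y z - k x x| ≤ 2 * ε := by
  have h1 := hy z
  have h2 := hz x
  rw [h.symm z x] at h2
  rw [abs_le] at h1 h2 ⊢
  constructor <;> linarith [h1.1, h1.2, h2.1, h2.2]

/-- The remainders of the eigenfunction expansion are nonnegative on the diagonal. -/
lemma truncRem_diag_nonneg : ∀ᵐ x ∂P, ∀ N, 0 ≤ truncRem k lam e N x x := by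
  filter_upwards [h.oscillation] with x hx N
  let L : ℕ → ℝ := fun i => (lam i)⁻¹ * ∫ z, |e i z| ∂P
  have hL : ∀ i, 0 ≤ L i := fun i =>
    mul_nonneg (inv_nonneg.2 (h.lam_pos i).le) (integral_nonneg fun _ => abs_nonneg _)
  -- The added expression bounds how far the remainder on `B × B` can exceed its value at `(x, x)`.
  -- It vanishes with `ε`, so nonnegativity of the sum for each `ε > 0` suffices.
  have hlim : Filter.Tendsto (fun ε : ℝ => truncRem k lam e N x x + (2 * ε +
      ∑ i ∈ Finset.range N, lam i * (2 * |e i x| * (ε * L i) + (ε * L i) ^ 2)))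
      (nhdsWithin 0 (Set.Ioi 0)) (nhds (truncRem k lam e N x x)) := by
    refine Filter.Tendsto.mono_left ?_ nhdsWithin_le_nhds
    refine Continuous.tendsto' (by fun_prop) _ _ ?_
    simp
  refine ge_of_tendsto hlim ?_
  filter_upwards [self_mem_nhdsWithin] with ε hε
  obtain ⟨B, hB, hPB, hosc⟩ := hx ε hε
  -- Otherwise the remainder is at most a negative constant on all of `B × B`, and its integral
  -- there is negative.
  by_contra! hneg
  set b := truncRem k lam e N x x + (2 * ε +
      ∑ i ∈ Finset.range N, lam i * (2 * |e i x| * (ε * L i) + (ε * L i) ^ 2)) with hb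
  have hle : ∀ y ∈ B, ∀ z ∈ B, truncRem k lam e N y z ≤ b := by
    intro y hy z hz
    have h1 := abs_le.1 (h.abs_kernel_diag_sub_le (hosc y hy) (hosc z hz))
    have h2 : truncKernel lam e N x x - truncKernel lam e N y z ≤
        ∑ i ∈ Finset.range N, lam i * (2 * |e i x| * (ε * L i) + (ε * L i) ^ 2) := by
      simp only [truncKernel]
      rw [← Finset.sum_sub_distrib]
      refine Finset.sum_le_sum fun i _ => ?_
      have e1 := h.abs_eigenfun_sub_le (hosc y hy) i
      have e2 := h.abs_eigenfun_sub_le (hosc z hz) i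
      have e3 : e i x * e i x - e i y * e i z ≤ 2 * |e i x| * (ε * L i) + (ε * L i) ^ 2 := by
        have : e i x * e i x - e i y * e i z = e i x * (e i x - e i y) + e i x * (e i x - e i z)
          - (e i x - e i y) * (e i x - e i z) := by ring
        rw [this]
        have a1 : e i x * (e i x - e i y) ≤ |e i x| * (ε * L i) := by
          refine (le_abs_self _).trans ?_
          rw [abs_mul]; gcongr
        have a2 : e i x * (e i x - e i z) ≤ |e i x| * (ε * L i) := by
          refine (le_abs_self _).trans ?_
          rw [abs_mul]; gcongr
        have a3 : -((e i x - e i y) * (e i x - e i z)) ≤ (ε * L i) * (ε * L i) := by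
          refine (neg_le_abs _).trans ?_
          rw [abs_mul]
          have : 0 ≤ ε * L i := mul_nonneg (le_of_lt hε) (hL i)
          gcongr
        nlinarith
      calc lam i * e i x * e i x - lam i * e i y * e i z
          = lam i * (e i x * e i x - e i y * e i z) := by ring
        _ ≤ _ := mul_le_mul_of_nonneg_left e3 (h.lam_pos i).le
    rw [hb]
    simp only [truncRem]
    linarith [h1.2]
  have hBr : 0 < P.real B := ENNReal.toReal_pos hPB.ne' (measure_ne_top _ _)
  have hint : ∀ y, Integrable (truncRem k lam e N y) (P.restrict B) := fun y =>
    ((h.memLp_truncRem N y).integrable (by norm_num)).restrict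
  have hin : ∀ y ∈ B, ∫ z in B, truncRem k lam e N y z ∂P ≤ b * P.real B := by
    intro y hy
    calc ∫ z in B, truncRem k lam e N y z ∂P ≤ ∫ _ in B, b ∂P :=
          setIntegral_mono_on (hint y) (integrable_const _) hB (hle y hy)
      _ = b * P.real B := by simp [mul_comm]
  have hlt : b * P.real B < 0 := mul_neg_of_neg_of_pos hneg hBr
  have hout : ∫ y in B, ∫ z in B, truncRem k lam e N y z ∂P ∂P ≤ b * P.real B * P.real B := by
    calc _ ≤ ∫ _ in B, b * P.real B ∂P :=
          setIntegral_mono_on (h.integrableOn_setIntegral_truncRem B N) (integrable_const _) hB hin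
      _ = b * P.real B * P.real B := by simp [mul_comm]
  have := h.setIntegral_truncRem_nonneg hB N
  nlinarith

end IsMercerSystem

end TKRR

/-! ### Mercer's theorem on the diagonal, the trace, and mean squares of remainders. -/

namespace TKRR

set_option linter.unusedSectionVars false

namespace IsMercerSystem

variable {d : ℕ} {P : Measure (E d)} [IsProbabilityMeasure P] {k : E d → E d → ℝ} {κ : ℝ}
  {lam : ℕ → ℝ} {e : ℕ → E d → ℝ} (h : IsMercerSystem P k κ lam e)

include h

lemma truncKernel_diag (N : ℕ) (x : E d) :
    truncKernel lam e N x x = ∑ i ∈ Finset.range N, lam i * e i x ^ 2 :=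
  Finset.sum_congr rfl fun i _ => by ring

lemma mul_sq_nonneg (i : ℕ) (x : E d) : 0 ≤ lam i * e i x ^ 2 :=
  mul_nonneg (h.lam_pos i).le (sq_nonneg _)

lemma summable_of_diag_nonneg {x : E d} (hx : ∀ N, 0 ≤ truncRem k lam e N x x) :
    Summable (fun i => lam i * e i x ^ 2) ∧ ∑' i, lam i * e i x ^ 2 ≤ k x x := by
  have hle : ∀ N, ∑ i ∈ Finset.range N, lam i * e i x ^ 2 ≤ k x x := fun N => by
    have := hx N
    rw [truncRem, h.truncKernel_diag] at this
    linarith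
  have hs : Summable (fun i => lam i * e i x ^ 2) :=
    summable_of_sum_range_le (fun i => h.mul_sq_nonneg i x) hle
  exact ⟨hs, hs.tsum_le_of_sum_range_le hle⟩

/-- The remainders of the eigenfunction expansion in mean square. -/
lemma integral_truncRem_sq_le :
    ∀ᵐ x ∂P, ∀ N, ∫ y, truncRem k lam e N x y ^ 2 ∂P ≤ κ * lam N := by
  filter_upwards [h.truncRem_diag_nonneg] with x hx N
  obtain ⟨hs, hle⟩ := h.summable_of_diag_nonneg hx
  have hle' : ∑' i, lam i * e i x ^ 2 ≤ κ := hle.trans ((le_abs_self _).trans (h.abs_kernel_le x x))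
  -- For `i ≥ N` one factor `lam i` is replaced by `lam N`; what remains is the diagonal series,
  -- bounded by `κ`.
  have h1 := hasSum_le (fun i => ?_) (h.hasSum_integral_truncRem_sq N x)
    (hs.hasSum.mul_left (lam N))
  · have h2 := mul_le_mul_of_nonneg_left hle' (h.lam_pos N).le
    linarith
  · split_ifs with hi
    · exact mul_nonneg (h.lam_pos N).le (h.mul_sq_nonneg i x)
    · have h3 : lam i ≤ lam N := h.antitone (not_lt.1 hi)
      have h4 := mul_le_mul_of_nonneg_right h3 (h.mul_sq_nonneg i x)
      nlinarith

/-- **Mercer's theorem** on the diagonal: the kernel is the sum of its eigenfunction expansion. -/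
lemma hasSum_diag : ∀ᵐ x ∂P, HasSum (fun i => lam i * e i x ^ 2) (k x x) := by
  filter_upwards [h.truncRem_diag_nonneg, h.oscillation, h.integral_truncRem_sq_le]
    with x hx hosc hR
  obtain ⟨hs, hle⟩ := h.summable_of_diag_nonneg hx
  suffices hge : k x x ≤ ∑' i, lam i * e i x ^ 2 by
    rw [le_antisymm hge hle]
    exact hs.hasSum
  refine le_of_forall_pos_le_add fun δ hδ => ?_
  obtain ⟨B, hB, hPB, hB'⟩ := hosc (δ / 3) (by positivity)
  set ε := δ / 3 with hε
  have hε0 : 0 < ε := by positivity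
  -- The possible defect in the diagonal expansion. It is bounded on `B` by off-diagonal remainders,
  -- whose mean squares tend to zero.
  set r := k x x - ∑' i, lam i * e i x ^ 2 with hr
  have hBr : 0 < P.real B := ENNReal.toReal_pos hPB.ne' (measure_ne_top _ _)
  have hbound : ∀ N, (r - 3 * ε) * P.real B ≤ ε⁻¹ * (κ * lam N) := by
    intro N
    have hint : Integrable (fun y => ε⁻¹ * truncRem k lam e N x y ^ 2) P :=
      (h.memLp_truncRem N x).integrable_sq.const_mul _
    have hpt : ∀ᵐ y ∂P, y ∈ B → r - 3 * ε ≤ ε⁻¹ * truncRem k lam e N x y ^ 2 := by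
      filter_upwards [h.truncRem_diag_nonneg] with y hy hyB
      have h1 := abs_le.1 (hB' y hyB x)
      have h2 := abs_le.1 (hB' y hyB y)
      rw [h.symm y x] at h1
      have h3 : r ≤ truncRem k lam e N x x := by
        rw [truncRem, h.truncKernel_diag, hr]
        have := hs.sum_le_tsum (Finset.range N) fun i _ => h.mul_sq_nonneg i x
        linarith
      have h4 := hy N
      -- The truncated kernel is positive semi-definite, so its off-diagonal value is at most the
      -- mean of the two diagonal ones.
      have h5 : 0 ≤ truncKernel lam e N x x - 2 * truncKernel lam e N x y
          + truncKernel lam e N y y := by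
        simp only [truncKernel]
        rw [Finset.mul_sum, ← Finset.sum_sub_distrib, ← Finset.sum_add_distrib]
        refine Finset.sum_nonneg fun i _ => ?_
        have := mul_nonneg (h.lam_pos i).le (sq_nonneg (e i x - e i y))
        nlinarith
      have h6 : r ≤ 2 * ε + 2 * truncRem k lam e N x y := by
        simp only [truncRem] at h3 h4 ⊢
        linarith [h1.2, h2.1]
      -- Young's inequality trades the remainder for its square, which is small in mean; the spare
      -- `ε` makes the total `3 * ε = δ`.
      have h7 : 2 * truncRem k lam e N x y ≤ ε + ε⁻¹ * truncRem k lam e N x y ^ 2 := by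
        have : ε + ε⁻¹ * truncRem k lam e N x y ^ 2 - 2 * truncRem k lam e N x y
            = ε⁻¹ * (ε - truncRem k lam e N x y) ^ 2 := by
          field_simp
          ring
        have h8 : 0 ≤ ε⁻¹ * (ε - truncRem k lam e N x y) ^ 2 := by positivity
        linarith
      linarith
    calc (r - 3 * ε) * P.real B = ∫ _ in B, (r - 3 * ε) ∂P := by simp [mul_comm]
      _ ≤ ∫ y in B, ε⁻¹ * truncRem k lam e N x y ^ 2 ∂P := by
          refine setIntegral_mono_on_ae (integrable_const _) hint.integrableOn hB hpt
      _ ≤ ∫ y, ε⁻¹ * truncRem k lam e N x y ^ 2 ∂P :=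
          setIntegral_le_integral hint (Filter.Eventually.of_forall fun y => by positivity)
      _ = ε⁻¹ * ∫ y, truncRem k lam e N x y ^ 2 ∂P := integral_const_mul _ _
      _ ≤ ε⁻¹ * (κ * lam N) := by gcongr; exact hR N
  have hlim : Filter.Tendsto (fun N => ε⁻¹ * (κ * lam N)) Filter.atTop (nhds 0) := by
    simpa using (h.tendsto_lam.const_mul κ).const_mul ε⁻¹
  have hfin := ge_of_tendsto' hlim hbound
  have : r - 3 * ε ≤ 0 := by
    by_contra! hc
    have := mul_pos hc hBr
    linarith
  linarith

lemma integrable_kernel_diag : Integrable (fun x => k x x) P :=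
  Integrable.of_bound (h.measurable_kernel.comp (measurable_id.prodMk measurable_id)).aestronglyMeasurable
    κ (Filter.Eventually.of_forall fun x => h.abs_kernel_le x x)

/-- The trace of the kernel operator is at most the bound of the kernel. -/
lemma sum_lam_le (n : ℕ) : ∑ i ∈ Finset.range n, lam i ≤ κ := by
  have h1 : ∑ i ∈ Finset.range n, lam i = ∫ x, ∑ i ∈ Finset.range n, lam i * e i x ^ 2 ∂P := by
    rw [integral_finsetSum _ fun i _ => (h.integrable_eigenfun_sq i).const_mul _]
    refine Finset.sum_congr rfl fun i _ => ?_
    rw [integral_const_mul, h.integral_eigenfun_sq, mul_one]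
  rw [h1]
  calc _ ≤ ∫ _, κ ∂P := by
        refine integral_mono_ae (integrable_finsetSum _ fun i _ =>
          (h.integrable_eigenfun_sq i).const_mul _) (integrable_const _) ?_
        filter_upwards [h.hasSum_diag] with x hx
        exact (sum_le_hasSum _ (fun i _ => h.mul_sq_nonneg i x) hx).trans
          ((le_abs_self _).trans (h.abs_kernel_le x x))
    _ = κ := by simp

lemma summable_lam : Summable lam :=
  summable_of_sum_range_le (fun i => (h.lam_pos i).le) h.sum_lam_le

lemma tsum_lam_le (N : ℕ) : ∑' i, lam (i + N) ≤ κ := by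
  have h1 := h.summable_lam.sum_add_tsum_nat_add N
  have h2 := h.summable_lam.tsum_le_of_sum_range_le h.sum_lam_le
  have h3 : 0 ≤ ∑ i ∈ Finset.range N, lam i := Finset.sum_nonneg fun i _ => (h.lam_pos i).le
  linarith

/-- By Mercer's theorem the diagonal remainder is a tail of nonnegative terms with summable
integrals, so it integrates term by term. -/
lemma integral_truncRem_diag (N : ℕ) :
    ∫ x, truncRem k lam e N x x ∂P = ∑' i, lam (i + N) := by
  have h1 : ∫ x, truncRem k lam e N x x ∂P = ∫ x, ∑' i, lam (i + N) * e (i + N) x ^ 2 ∂P := by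
    refine integral_congr_ae ?_
    filter_upwards [h.hasSum_diag] with x hx
    have := (hasSum_nat_add_iff' N).2 hx
    rw [this.tsum_eq, truncRem, h.truncKernel_diag]
  have h2 : ∀ i, ∫ x, lam i * e i x ^ 2 ∂P = lam i := fun i => by
    rw [integral_const_mul, h.integral_eigenfun_sq, mul_one]
  have h3 := hasSum_integral_of_summable_integral_norm (μ := P)
    (F := fun i x => lam (i + N) * e (i + N) x ^ 2)
    (fun i => (h.integrable_eigenfun_sq _).const_mul _) (by
      have : ∀ i, ∫ x, ‖lam (i + N) * e (i + N) x ^ 2‖ ∂P = lam (i + N) := fun i => by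
        simp only [Real.norm_of_nonneg (h.mul_sq_nonneg _ _), h2]
      simp only [this]
      exact (summable_nat_add_iff N).2 h.summable_lam)
  rw [h1, ← h3.tsum_eq]
  simp only [h2]

lemma integrable_truncRem_diag (N : ℕ) : Integrable (fun x => truncRem k lam e N x x) P := by
  simp only [truncRem, h.truncKernel_diag]
  exact h.integrable_kernel_diag.sub
    (integrable_finsetSum _ fun i _ => (h.integrable_eigenfun_sq i).const_mul _)

/-- The diagonal of the remainder in mean square. -/
lemma integral_truncRem_diag_sq_le (N : ℕ) :
    ∫ x, truncRem k lam e N x x ^ 2 ∂P ≤ κ * ∑' i, lam (i + N) := by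
  rw [← h.integral_truncRem_diag, ← integral_const_mul]
  refine integral_mono_of_nonneg (Filter.Eventually.of_forall fun x => sq_nonneg _)
    ((h.integrable_truncRem_diag N).const_mul κ) ?_
  filter_upwards [h.truncRem_diag_nonneg] with x hx
  -- Values in `[0, κ]` satisfy `t² ≤ κ t`, which reduces the mean square to the trace of the tail.
  have h1 : truncRem k lam e N x x ≤ κ := by
    refine le_trans ?_ ((le_abs_self _).trans (h.abs_kernel_le x x))
    rw [truncRem, h.truncKernel_diag]
    have := Finset.sum_nonneg fun i (_ : i ∈ Finset.range N) => h.mul_sq_nonneg i x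
    linarith
  simp only [sq]
  exact mul_le_mul_of_nonneg_right h1 (hx N)

lemma abs_truncRem_diag_le (N : ℕ) : ∀ᵐ x ∂P, |truncRem k lam e N x x| ≤ κ := by
  filter_upwards [h.truncRem_diag_nonneg] with x hx
  rw [abs_of_nonneg (hx N)]
  refine le_trans ?_ ((le_abs_self _).trans (h.abs_kernel_le x x))
  rw [truncRem, h.truncKernel_diag]
  have := Finset.sum_nonneg fun i (_ : i ∈ Finset.range N) => h.mul_sq_nonneg i x
  linarith

end IsMercerSystem

end TKRR

namespace TKRR

/-! ### From the kernel on `S` to a Mercer system on the whole space. -/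

section Restriction

variable {d : ℕ} {S : Set (E d)} {K : E d → E d → ℝ}

/-- The kernel `K` extended by zero outside `S × S`. -/
def restrictKernel (S : Set (E d)) (K : E d → E d → ℝ) (x y : E d) : ℝ :=
  (S ×ˢ S).indicator (fun p : E d × E d => K p.1 p.2) (x, y)

lemma restrictKernel_of_mem {x y : E d} (hx : x ∈ S) (hy : y ∈ S) :
    restrictKernel S K x y = K x y :=
  Set.indicator_of_mem (Set.mk_mem_prod hx hy) _

lemma restrictKernel_of_notMem_left {x : E d} (hx : x ∉ S) (y : E d) :
    restrictKernel S K x y = 0 :=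
  Set.indicator_of_notMem (fun h => hx h.1) _

lemma restrictKernel_of_notMem_right {y : E d} (hy : y ∉ S) (x : E d) :
    restrictKernel S K x y = 0 :=
  Set.indicator_of_notMem (fun h => hy h.2) _

lemma IsMercerKernel.symm (hK : IsMercerKernel S K) {x y : E d} (hx : x ∈ S) (hy : y ∈ S) :
    K x y = K y x := by
  have h := (hK.posSemidef 2 ![x, y] (by
    intro i
    fin_cases i
    · exact hx
    · exact hy)).1
  have h2 := congrFun (congrFun h 1) 0
  simpa using h2

lemma measurable_restrictKernel (hS : IsCompact S) (hK : IsMercerKernel S K) :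
    Measurable (Function.uncurry (restrictKernel S K)) := by
  classical
  have h : Measurable ((S ×ˢ S).piecewise (fun p : E d × E d => K p.1 p.2) 0) :=
    hK.continuousOn.measurable_piecewise continuousOn_const
      (hS.isClosed.measurableSet.prod hS.isClosed.measurableSet)
  rw [Set.piecewise_eq_indicator] at h
  exact h

lemma exists_abs_restrictKernel_le (hS : IsCompact S) (hK : IsMercerKernel S K) :
    ∃ κ : ℝ, ∀ x y, |restrictKernel S K x y| ≤ κ := by
  obtain ⟨C, hC⟩ := (hS.prod hS).exists_bound_of_continuousOn hK.continuousOn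
  refine ⟨max C 0, fun x y => ?_⟩
  by_cases hx : x ∈ S
  · by_cases hy : y ∈ S
    · rw [restrictKernel_of_mem hx hy]
      exact (hC (x, y) ⟨hx, hy⟩).trans (le_max_left _ _)
    · rw [restrictKernel_of_notMem_right hy, abs_zero]
      exact le_max_right _ _
  · rw [restrictKernel_of_notMem_left hx, abs_zero]
    exact le_max_right _ _

lemma restrictKernel_symm (hK : IsMercerKernel S K) (x y : E d) :
    restrictKernel S K x y = restrictKernel S K y x := by
  by_cases hx : x ∈ S
  · by_cases hy : y ∈ S
    · rw [restrictKernel_of_mem hx hy, restrictKernel_of_mem hy hx, hK.symm hx hy]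
    · rw [restrictKernel_of_notMem_right hy, restrictKernel_of_notMem_left hy]
  · rw [restrictKernel_of_notMem_left hx, restrictKernel_of_notMem_right hx]

/-- Uniform continuity on the compact square `S ×ˢ S`. It yields both the compactness of the
operator and the oscillation condition. -/
lemma exists_restrictKernel_sub_le (hS : IsCompact S) (hK : IsMercerKernel S K) {ε : ℝ}
    (hε : 0 < ε) : ∃ δ > 0, ∀ x ∈ S, ∀ y ∈ S, dist x y < δ →
      ∀ z, |restrictKernel S K x z - restrictKernel S K y z| ≤ ε := by
  have hu := (hS.prod hS).uniformContinuousOn_of_continuous hK.continuousOn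
  rw [Metric.uniformContinuousOn_iff] at hu
  obtain ⟨δ, hδ, h⟩ := hu ε hε
  refine ⟨δ, hδ, fun x hx y hy hxy z => ?_⟩
  by_cases hz : z ∈ S
  · rw [restrictKernel_of_mem hx hz, restrictKernel_of_mem hy hz]
    refine (h (x, z) ⟨hx, hz⟩ (y, z) ⟨hy, hz⟩ ?_).le
    simpa [Prod.dist_eq] using hxy
  · rw [restrictKernel_of_notMem_right hz, restrictKernel_of_notMem_right hz]
    simpa using hε.le

/-- A compact set is uniformly approximated by the values of a simple function. -/
lemma exists_simpleFunc_dist_lt (hS : IsCompact S) (hne : S.Nonempty) {δ : ℝ} (hδ : 0 < δ) :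
    ∃ s : SimpleFunc (E d) (E d), ∀ x ∈ S, s x ∈ S ∧ dist x (s x) < δ := by
  obtain ⟨t, htS, htf, hcov⟩ := hS.finite_cover_balls hδ
  have htne : t.Nonempty := by
    obtain ⟨x, hx⟩ := hne
    obtain ⟨c, hc, -⟩ := Set.mem_iUnion₂.1 (hcov hx)
    exact ⟨c, hc⟩
  obtain ⟨e, rfl⟩ := htf.countable.exists_eq_range htne
  have hidx : ∀ c ∈ Set.range e, ∃ i, e i = c := fun c hc => hc
  choose! idx hidx using hidx
  refine ⟨SimpleFunc.nearestPt e (htf.toFinset.sup idx), fun x hx => ⟨htS ⟨_, rfl⟩, ?_⟩⟩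
  obtain ⟨c, hc, hxc⟩ := Set.mem_iUnion₂.1 (hcov hx)
  have h1 := SimpleFunc.edist_nearestPt_le e x
    (Finset.le_sup (f := idx) (htf.mem_toFinset.2 hc))
  rw [hidx c hc, edist_dist, edist_dist, ENNReal.ofReal_le_ofReal_iff dist_nonneg] at h1
  rw [dist_comm]
  exact h1.trans_lt (by rw [dist_comm]; exact hxc)

variable {P : Measure (E d)}

lemma ae_mem_of_measure_compl (hPS : P Sᶜ = 0) : ∀ᵐ x ∂P, x ∈ S := hPS

lemma kernelOp_restrictKernel (hPS : P Sᶜ = 0) (f : E d → ℝ) {x : E d} (hx : x ∈ S) :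
    kernelOp P (restrictKernel S K) f x = kernelOp P K f x := by
  refine integral_congr_ae ?_
  filter_upwards [ae_mem_of_measure_compl hPS] with y hy
  rw [restrictKernel_of_mem hx hy]

lemma kernelOp_congr_ae (k : E d → E d → ℝ) {f g : E d → ℝ} (hfg : f =ᵐ[P] g) (x : E d) :
    kernelOp P k f x = kernelOp P k g x := by
  refine integral_congr_ae ?_
  filter_upwards [hfg] with y hy
  rw [hy]

/-- An eigenfunction for the eigenvalue zero would vanish by injectivity, against its norm being
one. -/
lemma IsEigenSystem.lam_ne_zero [IsProbabilityMeasure P] {lam : ℕ → ℝ} {φ : ℕ → E d → ℝ}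
    (hsys : IsEigenSystem S P K lam φ) (hPS : P Sᶜ = 0) (hH0 : OneToOne P K) (i : ℕ) :
    lam i ≠ 0 := by
  intro h0
  have h1 : kernelOp P K (φ i) =ᵐ[P] 0 := by
    filter_upwards [ae_mem_of_measure_compl hPS] with x hx
    rw [hsys.eigen i x hx, h0, zero_mul, Pi.zero_apply]
  have h2 := hH0 (φ i) (hsys.memLp i) h1
  have h3 := hsys.orthonormal i i
  rw [integral_congr_ae (g := fun _ => (0 : ℝ)) (by
    filter_upwards [h2] with x hx
    rw [hx, Pi.zero_apply, zero_mul])] at h3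
  simp at h3

/-- The eigenfunctions form a complete orthonormal system. -/
lemma IsEigenSystem.hasSum_mul [IsProbabilityMeasure P] (hS : IsCompact S) (hPS : P Sᶜ = 0)
    (hK : IsMercerKernel S K) {lam : ℕ → ℝ} {φ : ℕ → E d → ℝ}
    (hsys : IsEigenSystem S P K lam φ) {f g : E d → ℝ} (hf : MemLp f 2 P) (hg : MemLp g 2 P) :
    HasSum (fun i => (∫ x, f x * φ i x ∂P) * ∫ x, g x * φ i x ∂P) (∫ x, f x * g x ∂P) := by
  have hae := ae_mem_of_measure_compl hPS
  have hne : S.Nonempty := by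
    obtain ⟨x, hx⟩ := hae.exists
    exact ⟨x, hx⟩
  have hkm := measurable_restrictKernel hS hK
  obtain ⟨κ, hκ⟩ := exists_abs_restrictKernel_le hS hK
  have hinner : ∀ {u v : E d → ℝ} (hu : MemLp u 2 P) (hv : MemLp v 2 P),
      inner ℝ (hu.toLp u) (hv.toLp v) = ∫ x, u x * v x ∂P := by
    intro u v hu hv
    rw [L2.inner_def]
    refine integral_congr_ae ?_
    filter_upwards [hu.coeFn_toLp, hv.coeFn_toLp] with x h1 h2
    rw [h1, h2]
    simp [mul_comm]
  let T : Lp ℝ 2 P →L[ℝ] Lp ℝ 2 P := intOp hkm hκ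
  let v : ℕ → Lp ℝ 2 P := fun i => (hsys.memLp i).toLp (φ i)
  have hTc : IsCompactOperator T := by
    refine intOp_isCompactOperator hkm hκ fun ε hε => ?_
    obtain ⟨δ, hδ, h⟩ := exists_restrictKernel_sub_le hS hK hε
    obtain ⟨s, hs⟩ := exists_simpleFunc_dist_lt hS hne hδ
    refine ⟨s, ?_⟩
    filter_upwards [hae] with x hx
    exact Filter.Eventually.of_forall (h x hx (s x) (hs x hx).1 (hs x hx).2)
  have hTs : T.IsSymmetric := intOp_isSymmetric hkm hκ (restrictKernel_symm hK)
  have hTf : ∀ u : Lp ℝ 2 P, T u =ᵐ[P] kernelOp P K u := by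
    intro u
    filter_upwards [coeFn_intOp hkm hκ u, hae] with x h1 hx
    rw [h1, kernelOp_restrictKernel hPS _ hx]
  have hTv : ∀ i, T (v i) = lam i • v i := by
    intro i
    refine Lp.ext ?_
    filter_upwards [hTf (v i), Lp.coeFn_smul (lam i) (v i), (hsys.memLp i).coeFn_toLp, hae]
      with x h1 h2 h3 hx
    rw [h1, h2, Pi.smul_apply, h3, smul_eq_mul, kernelOp_congr_ae K (hsys.memLp i).coeFn_toLp,
      hsys.eigen i x hx]
  have hv : Orthonormal ℝ v := by
    rw [orthonormal_iff_ite]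
    intro i j
    rw [hinner (hsys.memLp i) (hsys.memLp j), hsys.orthonormal]
  have hbot := span_orthogonal_eq_bot_of_exhaustive hTc hTs hTv fun μ u hu hort => by
    have h1 := hsys.exhaustive μ u (Lp.memLp u) (by
      filter_upwards [hTf u, Lp.coeFn_smul μ u] with x h1 h2
      rw [← h1, hu, h2, Pi.smul_apply, smul_eq_mul]) fun i => by
        rw [← hort i, real_inner_comm, ← hinner (Lp.memLp u) (hsys.memLp i), Lp.toLp_coeFn]
    exact Lp.ext (h1.trans (Lp.coeFn_zero _ _ _).symm)
  let b := HilbertBasis.mkOfOrthogonalEqBot hv hbot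
  have hb : ⇑b = v := HilbertBasis.coe_mkOfOrthogonalEqBot hv hbot
  have := b.hasSum_inner_mul_inner (hf.toLp f) (hg.toLp g)
  rw [hb, hinner hf hg] at this
  have hc : ∀ {u : E d → ℝ} (hu : MemLp u 2 P) i,
      inner ℝ (hu.toLp u) (v i) = ∫ x, u x * φ i x ∂P := fun hu i => hinner hu (hsys.memLp i)
  simp only [real_inner_comm (hg.toLp g), hc] at this
  exact this

/-- The kernel and the eigenfunctions, cut off outside `S`, form a Mercer system. -/
lemma IsEigenSystem.exists_isMercerSystem [IsProbabilityMeasure P] (hS : IsCompact S)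
    (hPS : P Sᶜ = 0) (hK : IsMercerKernel S K) (hH0 : OneToOne P K) {lam : ℕ → ℝ}
    {φ : ℕ → E d → ℝ} (hsys : IsEigenSystem S P K lam φ) :
    ∃ κ, IsMercerSystem P (restrictKernel S K) κ lam (fun i => S.indicator (φ i)) := by
  have hae := ae_mem_of_measure_compl hPS
  have hkm := measurable_restrictKernel hS hK
  obtain ⟨κ, hκ⟩ := exists_abs_restrictKernel_le hS hK
  have hind : ∀ i, S.indicator (φ i) =ᵐ[P] φ i := by
    intro i
    filter_upwards [hae] with x hx
    exact Set.indicator_of_mem hx _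
  have hint : ∀ (f : E d → ℝ) i, ∫ x, f x * S.indicator (φ i) x ∂P = ∫ x, f x * φ i x ∂P := by
    intro f i
    refine integral_congr_ae ?_
    filter_upwards [hind i] with x hx
    rw [hx]
  have hlam := hsys.lam_ne_zero hPS hH0
  have hoff : ∀ (f : E d → ℝ) x, x ∉ S → kernelOp P (restrictKernel S K) f x = 0 := by
    intro f x hx
    simp [kernelOp, restrictKernel_of_notMem_left hx]
  have heig : ∀ i x, kernelOp P (restrictKernel S K) (φ i) x = lam i * S.indicator (φ i) x := by
    intro i x
    by_cases hx : x ∈ S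
    · rw [kernelOp_restrictKernel hPS _ hx, hsys.eigen i x hx, Set.indicator_of_mem hx]
    · rw [hoff _ _ hx, Set.indicator_of_notMem hx, mul_zero]
  refine ⟨κ, hkm, hκ, restrictKernel_symm hK, fun i => ?_, fun i => ?_, fun i j => ?_,
    fun i x => ?_, hsys.antitone, hlam, fun f g hf hg => ?_, ?_⟩
  -- A priori `φ i` is only almost everywhere measurable; the pointwise eigenvalue equation on `S`
  -- makes its cut-off measurable.
  · have : S.indicator (φ i) = fun x => (lam i)⁻¹ * kernelOp P (restrictKernel S K) (φ i) x := by
      funext x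
      rw [heig, inv_mul_cancel_left₀ (hlam i)]
    rw [this]
    exact (stronglyMeasurable_kernelOp hkm (hsys.memLp i).1).measurable.const_mul _
  · exact (hsys.memLp i).ae_eq (hind i).symm
  · rw [hint, ← hsys.orthonormal i j]
    refine integral_congr_ae ?_
    filter_upwards [hind i] with x hx
    rw [hx]
  · rw [kernelOp_congr_ae _ (hind i), heig]
  · simp only [hint]
    exact hsys.hasSum_mul hS hPS hK hf hg
  -- Balls around a point of the support have positive mass, which gives the set `B` of the
  -- oscillation condition.
  · have hsupp : ∀ᵐ x ∂P, x ∈ P.support := Measure.support_mem_ae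
    filter_upwards [hae, hsupp] with x hx hx' ε hε
    obtain ⟨δ, hδ, h⟩ := exists_restrictKernel_sub_le hS hK hε
    refine ⟨S ∩ Metric.ball x δ, hS.isClosed.measurableSet.inter measurableSet_ball, ?_, ?_⟩
    · rw [Set.inter_comm, measure_inter_conull hPS]
      exact (Measure.mem_support_iff_forall x).1 hx' _ (Metric.ball_mem_nhds x hδ)
    · intro y hy
      exact h x hx y hy.1 (by rw [dist_comm]; exact hy.2)

end Restriction

end TKRR

namespace TKRR

/-! ### The bias at a fixed sample. -/

section Deterministic

variable {d : ℕ} {S : Set (E d)} {K : E d → E d → ℝ} {n N : ℕ}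

lemma sqNorm_nonneg (n : ℕ) {m : ℕ} (u : Fin m → ℝ) : 0 ≤ sqNorm n u := by
  unfold sqNorm; positivity

lemma sqNorm_add_le (n : ℕ) {m : ℕ} (u v : Fin m → ℝ) :
    sqNorm n (fun i => u i + v i) ≤ 2 * sqNorm n u + 2 * sqNorm n v := by
  have h : ∑ i, (u i + v i) ^ 2 ≤ 2 * ∑ i, u i ^ 2 + 2 * ∑ i, v i ^ 2 := by
    rw [Finset.mul_sum, Finset.mul_sum, ← Finset.sum_add_distrib]
    exact Finset.sum_le_sum fun i _ => by nlinarith [sq_nonneg (u i - v i)]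
  have hn : (0 : ℝ) ≤ 1 / n := by positivity
  unfold sqNorm
  nlinarith [mul_le_mul_of_nonneg_left h hn]

lemma gram_restrictKernel (h : N ≤ n) {x : Fin n → E d} (hx : ∀ i, x i ∈ S) :
    gram (restrictKernel S K) h x = gram K h x := by
  ext i j
  simp [gram, restrictKernel_of_mem (hx _) (hx _)]

lemma kernelSum_eq_gram_mulVec (hK : IsMercerKernel S K) (h : N ≤ n) {x : Fin n → E d}
    (hx : ∀ i, x i ∈ S) (ω : Fin N → ℝ) (i : Fin n) :
    kernelSum K h x ω (x i) = (gram K h x *ᵥ ω) i := by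
  simp only [kernelSum, gram, Matrix.mulVec, dotProduct, Matrix.of_apply]
  exact Finset.sum_congr rfl fun j _ => by rw [hK.symm (hx _) (hx i)]; ring

/-- The estimator at the sample points is the hat matrix applied to the observations. -/
lemma tkrr_apply_sample (hK : IsMercerKernel S K) (h : N ≤ n) (α : ℝ) {x : Fin n → E d}
    (hx : ∀ i, x i ∈ S) (Y : Fin n → ℝ) (i : Fin n) :
    tkrr K h α x Y (x i) = (hatMatrix (gram K h x) α *ᵥ Y) i := by
  rw [tkrr, kernelSum_eq_gram_mulVec hK h hx, hatMatrix_mulVec]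
  rfl

lemma truncKernel_indicator {lam : ℕ → ℝ} {φ : ℕ → E d → ℝ} {x y : E d} (hx : x ∈ S)
    (hy : y ∈ S) :
    truncKernel lam (fun i => S.indicator (φ i)) N x y = truncKernel lam φ N x y :=
  Finset.sum_congr rfl fun i _ => by
    simp only [Set.indicator_of_mem hx, Set.indicator_of_mem hy]

/-- The bias of the estimator is controlled by the projection error and by the remainder of the
kernel expansion. -/
lemma sqNorm_bias_le (hK : IsMercerKernel S K) {P : Measure (E d)} {lam : ℕ → ℝ}
    {φ : ℕ → E d → ℝ} {f : E d → ℝ} (h : N ≤ n) {α : ℝ} (hα : 0 < α) {x : Fin n → E d}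
    (hx : ∀ i, x i ∈ S) (hb : BoundedCoeffs S P K lam φ f h x) :
    sqNorm n (fun i => (hatMatrix (gram K h x) α *ᵥ fun k => f (x k)) i - f (x i)) ≤
      α + 2 * sqNorm n (fun i => f (x i) - projN P φ N f (x i)) +
      2 * ((1 / (n : ℝ)) ^ 2 * ∑ i, ∑ j : Fin N, truncRem (restrictKernel S K) lam
        (fun m => S.indicator (φ m)) N (x (Fin.castLE h j)) (x i) ^ 2) := by
  obtain ⟨_, ω, _, hω, hle⟩ := hb
  have hω1 : sqNorm n ω ≤ 1 := (le_max_right _ _).trans hle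
  set Rm : E d → E d → ℝ := truncRem (restrictKernel S K) lam (fun m => S.indicator (φ m)) N
  have hn : (0 : ℝ) ≤ 1 / n := by positivity
  let r : Fin n → ℝ := fun i => ∑ j, ω j * ((1 / (n : ℝ)) * Rm (x (Fin.castLE h j)) (x i))
  -- With `K_N` in place of `K` the vector `ω` reproduces the spectral projection exactly; `r` is
  -- the cost of using `K`.
  have hdec : ∀ i, (gram K h x *ᵥ ω) i - f (x i) = -(f (x i) - projN P φ N f (x i)) + r i := by
    intro i
    rw [hω _ (hx i), ← kernelSum_eq_gram_mulVec hK h hx]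
    simp only [kernelSum, r]
    have : ∀ j, ω j * (1 / (n : ℝ) * K (x (Fin.castLE h j)) (x i))
        = ω j * (1 / (n : ℝ) * truncKernel lam φ N (x (Fin.castLE h j)) (x i))
          + ω j * (1 / (n : ℝ) * Rm (x (Fin.castLE h j)) (x i)) := by
      intro j
      simp only [Rm, truncRem]
      rw [truncKernel_indicator (hx _) (hx _), restrictKernel_of_mem (hx _) (hx _)]
      ring
    simp only [this, Finset.sum_add_distrib]
    ring
  -- Cauchy-Schwarz; one of the two factors `1 / n` is absorbed in `sqNorm n ω ≤ 1`.
  have hr : ∀ i, r i ^ 2 ≤ (1 / (n : ℝ)) * ∑ j : Fin N, Rm (x (Fin.castLE h j)) (x i) ^ 2 := by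
    intro i
    have hcs := Finset.sum_mul_sq_le_sq_mul_sq Finset.univ ω
      (fun j => Rm (x (Fin.castLE h j)) (x i))
    have hri : r i = (1 / (n : ℝ)) * ∑ j, ω j * Rm (x (Fin.castLE h j)) (x i) := by
      simp only [r, Finset.mul_sum]
      exact Finset.sum_congr rfl fun j _ => by ring
    rw [hri, mul_pow]
    have h0 : 0 ≤ ∑ j : Fin N, Rm (x (Fin.castLE h j)) (x i) ^ 2 := by positivity
    calc (1 / (n : ℝ)) ^ 2 * (∑ j, ω j * Rm (x (Fin.castLE h j)) (x i)) ^ 2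
        ≤ (1 / (n : ℝ)) ^ 2 * ((∑ j, ω j ^ 2) * ∑ j, Rm (x (Fin.castLE h j)) (x i) ^ 2) := by
          gcongr
      _ = sqNorm n ω * ((1 / (n : ℝ)) * ∑ j, Rm (x (Fin.castLE h j)) (x i) ^ 2) := by
          rw [sqNorm]; ring
      _ ≤ 1 * ((1 / (n : ℝ)) * ∑ j, Rm (x (Fin.castLE h j)) (x i) ^ 2) := by gcongr
      _ = _ := one_mul _
  have h1 : sqNorm n (fun i => (hatMatrix (gram K h x) α *ᵥ fun k => f (x k)) i - f (x i)) ≤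
      sqNorm n (fun i => (gram K h x *ᵥ ω) i - f (x i)) + α * sqNorm n ω := by
    have := mul_le_mul_of_nonneg_left
      (sum_sq_hatMatrix_sub_le (gram K h x) hα (fun k => f (x k)) ω) hn
    simp only [sqNorm]
    linarith
  have h2 : sqNorm n (fun i => (gram K h x *ᵥ ω) i - f (x i)) ≤
      2 * sqNorm n (fun i => f (x i) - projN P φ N f (x i)) + 2 * sqNorm n r := by
    simp only [hdec]
    refine (sqNorm_add_le n _ _).trans (le_of_eq ?_)
    simp only [sqNorm, neg_sq]
  have h3 : sqNorm n r ≤ (1 / (n : ℝ)) ^ 2 * ∑ i, ∑ j : Fin N, Rm (x (Fin.castLE h j)) (x i) ^ 2 := by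
    have := mul_le_mul_of_nonneg_left (Finset.sum_le_sum fun i (_ : i ∈ Finset.univ) => hr i) hn
    rw [← Finset.mul_sum] at this
    rw [sqNorm, sq (1 / (n : ℝ)), mul_assoc]
    exact this
  nlinarith

end Deterministic

/-! ### Measurability of the hat matrix in the design. -/

section Measurability

variable {X : Type*} [MeasurableSpace X] {m : ℕ}

lemma measurable_det {M : X → Matrix (Fin m) (Fin m) ℝ} (hM : ∀ i j, Measurable fun x => M x i j) :
    Measurable fun x => (M x).det := by
  simp only [Matrix.det_apply']
  exact Finset.measurable_fun_sum _ fun σ _ =>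
    (Finset.measurable_fun_prod _ fun i _ => hM _ _).const_mul _

/-- Cramer's rule: the entries are polynomials in the entries of `M` times the inverse of the
determinant. -/
lemma measurable_inv_apply {M : X → Matrix (Fin m) (Fin m) ℝ}
    (hM : ∀ i j, Measurable fun x => M x i j) (i j : Fin m) :
    Measurable fun x => (M x)⁻¹ i j := by
  simp only [Matrix.inv_def, Ring.inverse_eq_inv', Matrix.smul_apply, smul_eq_mul,
    Matrix.adjugate_apply]
  refine (measurable_det hM).inv.mul (measurable_det fun a b => ?_)
  simp only [Matrix.updateRow_apply]
  split_ifs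
  · exact measurable_const
  · exact hM _ _

lemma measurable_hatMatrix_apply {n N : ℕ} {A : X → Matrix (Fin n) (Fin N) ℝ}
    (hA : ∀ i j, Measurable fun x => A x i j) (α : ℝ) (i k : Fin n) :
    Measurable fun x => hatMatrix (A x) α i k := by
  have h1 : ∀ i j, Measurable fun x => ridgeMatrix (A x) α i j := by
    intro i j
    simp only [ridgeMatrix, Matrix.add_apply, Matrix.mul_apply, Matrix.transpose_apply]
    exact (Finset.measurable_fun_sum _ fun l _ => (hA _ _).mul (hA _ _)).add_const _
  simp only [hatMatrix, Matrix.mul_apply, Matrix.transpose_apply]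
  exact Finset.measurable_fun_sum _ fun j _ => (Finset.measurable_fun_sum _ fun l _ =>
    (hA _ _).mul (measurable_inv_apply h1 _ _)).mul (hA _ _)

end Measurability

/-! ### The variance term. -/

section Noise

variable {n : ℕ} {ν : Measure ℝ} {σ : ℝ}

/-- The second moment of a linear combination of independent noise variables. -/
lemma IsNoiseLaw.lintegral_sq (hν : IsNoiseLaw ν σ) (c : Fin n → ℝ) :
    ∫⁻ t, ENNReal.ofReal ((∑ k, c k * t k) ^ 2) ∂(Measure.pi fun _ : Fin n => ν)
      = ENNReal.ofReal (σ ^ 2 * ∑ k, c k ^ 2) := by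
  have := hν.prob
  have hX : ∀ k : Fin n, MemLp (fun t : ℝ => c k * t) 2 ν := fun k => hν.memLp.const_mul _
  have hY : ∀ k : Fin n, MemLp (fun t : Fin n → ℝ => c k * t k) 2 (Measure.pi fun _ => ν) :=
    fun k => (hX k).comp_measurePreserving (measurePreserving_eval (fun _ : Fin n => ν) k)
  have hsum : MemLp (fun t : Fin n → ℝ => ∑ k, c k * t k) 2 (Measure.pi fun _ => ν) :=
    memLp_finsetSum _ fun k _ => hY k
  have hmean : ∫ t, ∑ k, c k * t k ∂(Measure.pi fun _ : Fin n => ν) = 0 := by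
    rw [integral_finsetSum _ fun k _ => (hY k).integrable (by norm_num)]
    refine Finset.sum_eq_zero fun k _ => ?_
    rw [integral_const_mul, integral_comp_eval (μ := fun _ : Fin n => ν) (f := fun t : ℝ => t)
      (i := k) hν.memLp.1, hν.mean, mul_zero]
  have hvar := ProbabilityTheory.variance_sum_pi (μ := fun _ : Fin n => ν)
    (X := fun k t => c k * t) hX
  have h1 : (∑ k, fun t : Fin n → ℝ => c k * t k) = fun t => ∑ k, c k * t k := by
    funext t
    simp
  have h2 : ∀ k, ProbabilityTheory.variance (fun t : ℝ => c k * t) ν = c k ^ 2 * σ ^ 2 := by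
    intro k
    rw [ProbabilityTheory.variance_const_mul, ProbabilityTheory.variance_of_integral_eq_zero
      hν.memLp.1.aemeasurable hν.mean, hν.variance]
  rw [h1, ProbabilityTheory.variance_of_integral_eq_zero hsum.1.aemeasurable hmean] at hvar
  simp only [h2] at hvar
  rw [← ofReal_integral_eq_lintegral_ofReal hsum.integrable_sq
    (Filter.Eventually.of_forall fun _ => sq_nonneg _), hvar, Finset.mul_sum]
  congr 1
  exact Finset.sum_congr rfl fun k _ => mul_comm _ _

/-- The variance of the estimator: the mean square of the hat matrix applied to the noise. -/
lemma IsNoiseLaw.lintegral_hatMatrix_le (hν : IsNoiseLaw ν σ) {X : Type*} [MeasurableSpace X]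
    (Q : Measure X) [IsProbabilityMeasure Q] {N : ℕ} {A : X → Matrix (Fin n) (Fin N) ℝ}
    (hA : ∀ i j, Measurable fun x => A x i j) {α : ℝ} (hα : 0 < α) :
    ∫⁻ p, ENNReal.ofReal (sqNorm n (hatMatrix (A p.1) α *ᵥ p.2))
      ∂(Q.prod (Measure.pi fun _ : Fin n => ν)) ≤ ENNReal.ofReal (σ ^ 2 * N / n) := by
  have := hν.prob
  have hH := measurable_hatMatrix_apply hA α
  have hm : Measurable fun p : X × (Fin n → ℝ) => sqNorm n (hatMatrix (A p.1) α *ᵥ p.2) := by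
    simp only [sqNorm, Matrix.mulVec, dotProduct]
    refine (Finset.measurable_fun_sum _ fun i _ =>
      (Finset.measurable_fun_sum _ fun k _ => ?_).pow_const 2).const_mul _
    exact ((hH i k).comp measurable_fst).mul ((measurable_pi_apply k).comp measurable_snd)
  -- The noise is integrated first, at a fixed design, where the bound by `N` on the Frobenius norm
  -- is uniform.
  rw [lintegral_prod _ hm.ennreal_ofReal.aemeasurable]
  refine (lintegral_mono fun x => ?_).trans_eq (lintegral_const (ENNReal.ofReal (σ ^ 2 * N / n))) |>.trans
    (by simp)
  have h1 : ∀ t : Fin n → ℝ, ENNReal.ofReal (sqNorm n (hatMatrix (A x) α *ᵥ t))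
      = ENNReal.ofReal (1 / n) *
        ∑ i, ENNReal.ofReal ((∑ k, hatMatrix (A x) α i k * t k) ^ 2) := by
    intro t
    rw [← ENNReal.ofReal_sum_of_nonneg fun i _ => sq_nonneg _,
      ← ENNReal.ofReal_mul (by positivity)]
    rfl
  simp only [h1]
  have h2 : ∀ i, Measurable fun t : Fin n → ℝ =>
      ENNReal.ofReal ((∑ k, hatMatrix (A x) α i k * t k) ^ 2) := fun i => by fun_prop
  rw [lintegral_const_mul _ (Finset.measurable_fun_sum _ fun i _ => h2 i),
    lintegral_finsetSum _ fun i _ => h2 i]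
  simp only [hν.lintegral_sq]
  rw [← ENNReal.ofReal_sum_of_nonneg fun i _ => by positivity,
    ← ENNReal.ofReal_mul (by positivity), ← Finset.mul_sum]
  refine ENNReal.ofReal_le_ofReal ?_
  have := mul_le_mul_of_nonneg_left (sum_sq_hatMatrix_le (A x) hα)
    (by positivity : 0 ≤ 1 / (n : ℝ) * σ ^ 2)
  calc _ = 1 / (n : ℝ) * σ ^ 2 * ∑ i, ∑ k, hatMatrix (A x) α i k ^ 2 := by ring
    _ ≤ 1 / (n : ℝ) * σ ^ 2 * N := this
    _ = _ := by ring

end Noise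

end TKRR

namespace TKRR

/-! ### Expectations over the design and the general risk bound. -/

section Sampling

lemma _root_.MeasureTheory.MeasurePreserving.lintegral_comp_aemeasurable {X Y : Type*}
    [MeasurableSpace X] [MeasurableSpace Y] {μ : Measure X} {ν : Measure Y} {T : X → Y}
    (hT : MeasurePreserving T μ ν) {g : Y → ℝ≥0∞} (hg : AEMeasurable g ν) :
    ∫⁻ x, g (T x) ∂μ = ∫⁻ y, g y ∂ν := by
  rw [← hT.map_eq] at hg ⊢
  rw [lintegral_map' hg hT.measurable.aemeasurable]

/-- Two distinct coordinates of an i.i.d. sample are independent with the common law. -/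
lemma measurePreserving_eval_pair {X : Type*} [MeasurableSpace X] {n : ℕ} (ρ : Measure X)
    [IsProbabilityMeasure ρ] {i j : Fin n} (hij : i ≠ j) :
    MeasurePreserving (fun x : Fin n → X => (x i, x j)) (Measure.pi fun _ => ρ) (ρ.prod ρ) := by
  have h := (ProbabilityTheory.iIndepFun_pi (μ := fun _ : Fin n => ρ) (X := fun _ => id)
    fun _ => aemeasurable_id).indepFun hij
  have hm := (ProbabilityTheory.indepFun_iff_map_prod_eq_prod_map_map
    (measurable_pi_apply i).aemeasurable (measurable_pi_apply j).aemeasurable).1 h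
  refine ⟨by fun_prop, ?_⟩
  have h1 := (measurePreserving_eval (fun _ : Fin n => ρ) i).map_eq
  have h2 := (measurePreserving_eval (fun _ : Fin n => ρ) j).map_eq
  exact hm.trans (congrArg₂ _ h1 h2)

lemma le_smul_of_rnDeriv_le {X : Type*} [MeasurableSpace X] {P ρ : Measure X} [IsFiniteMeasure P]
    [IsFiniteMeasure ρ] {D : ℝ≥0∞} (hac : ρ ≪ P) (hD : ∀ᵐ x ∂P, ρ.rnDeriv P x ≤ D) :
    ρ ≤ D • P := by
  rw [← Measure.withDensity_rnDeriv_eq ρ P hac, ← withDensity_const]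
  exact withDensity_mono hD

variable {d : ℕ} {P ρ : Measure (E d)} [IsProbabilityMeasure P] [IsProbabilityMeasure ρ] {D : ℝ≥0}

lemma BoundedDensity.le_smul (hρ : BoundedDensity P ρ D) : ρ ≤ (D : ℝ≥0∞) • P :=
  le_smul_of_rnDeriv_le hρ.1 hρ.2

lemma BoundedDensity.lintegral_le (hρ : BoundedDensity P ρ D) (g : E d → ℝ≥0∞) :
    ∫⁻ x, g x ∂ρ ≤ D * ∫⁻ x, g x ∂P := by
  refine (lintegral_mono' hρ.le_smul le_rfl).trans_eq ?_
  rw [lintegral_smul_measure, smul_eq_mul]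

namespace IsMercerSystem

variable {k : E d → E d → ℝ} {κ : ℝ} {lam : ℕ → ℝ} {e : ℕ → E d → ℝ}

lemma measurable_truncRem_comp (h : IsMercerSystem P k κ lam e) (N : ℕ) {X : Type*}
    [MeasurableSpace X] {u v : X → E d} (hu : Measurable u) (hv : Measurable v) :
    Measurable fun p => truncRem k lam e N (u p) (v p) :=
  (h.measurable_truncRem N).comp (hu.prodMk hv)

/-- This handles pairs of distinct sample points: each of the two integrations against `ρ` costs a
factor `D`. -/
lemma lintegral_truncRem_prod_le (h : IsMercerSystem P k κ lam e) (hρ : BoundedDensity P ρ D)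
    (N : ℕ) :
    ∫⁻ p, ENNReal.ofReal (truncRem k lam e N p.1 p.2 ^ 2) ∂(ρ.prod ρ) ≤
      ENNReal.ofReal (D ^ 2 * (κ * lam N)) := by
  have hm : Measurable fun p : E d × E d => ENNReal.ofReal (truncRem k lam e N p.1 p.2 ^ 2) :=
    ((h.measurable_truncRem N).pow_const 2).ennreal_ofReal
  rw [lintegral_prod _ hm.aemeasurable]
  have h1 : ∀ᵐ x ∂P, ∫⁻ y, ENNReal.ofReal (truncRem k lam e N x y ^ 2) ∂P ≤
      ENNReal.ofReal (κ * lam N) := by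
    filter_upwards [h.integral_truncRem_sq_le] with x hx
    rw [← ofReal_integral_eq_lintegral_ofReal (h.memLp_truncRem N x).integrable_sq
      (Filter.Eventually.of_forall fun _ => sq_nonneg _)]
    exact ENNReal.ofReal_le_ofReal (hx N)
  calc ∫⁻ x, ∫⁻ y, ENNReal.ofReal (truncRem k lam e N x y ^ 2) ∂ρ ∂ρ
      ≤ D * ∫⁻ x, ∫⁻ y, ENNReal.ofReal (truncRem k lam e N x y ^ 2) ∂ρ ∂P := hρ.lintegral_le _
    _ ≤ D * ∫⁻ _, D * ENNReal.ofReal (κ * lam N) ∂P := by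
        refine mul_le_mul' le_rfl (lintegral_mono_ae ?_)
        filter_upwards [h1] with x hx
        exact (hρ.lintegral_le _).trans (mul_le_mul' le_rfl hx)
    _ = ENNReal.ofReal (D ^ 2 * (κ * lam N)) := by
        rw [lintegral_const, measure_univ, mul_one,
          ENNReal.ofReal_mul (p := (D : ℝ) ^ 2) (by positivity), ENNReal.ofReal_pow D.coe_nonneg, ENNReal.ofReal_coe_nnreal]
        ring

/-- This handles a sample point paired with itself: the density is used once, and the whole
eigenvalue tail replaces `lam N`. -/
lemma lintegral_truncRem_diag_le (h : IsMercerSystem P k κ lam e) (hρ : BoundedDensity P ρ D)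
    (N : ℕ) :
    ∫⁻ x, ENNReal.ofReal (truncRem k lam e N x x ^ 2) ∂ρ ≤
      ENNReal.ofReal (D * (κ * ∑' i, lam (i + N))) := by
  have hb : Integrable (fun x => truncRem k lam e N x x ^ 2) P := by
    have hm : Measurable fun x => truncRem k lam e N x x :=
      h.measurable_truncRem_comp N measurable_id measurable_id
    refine Integrable.of_bound (hm.pow_const 2).aestronglyMeasurable (κ ^ 2) ?_
    filter_upwards [h.abs_truncRem_diag_le N] with x hx
    rw [Real.norm_of_nonneg (sq_nonneg _)]
    exact sq_le_sq' (abs_le.1 hx).1 (abs_le.1 hx).2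
  refine (hρ.lintegral_le _).trans ?_
  rw [← ofReal_integral_eq_lintegral_ofReal hb (Filter.Eventually.of_forall fun _ => sq_nonneg _),
    ENNReal.ofReal_mul D.coe_nonneg, ENNReal.ofReal_coe_nnreal]
  gcongr
  exact h.integral_truncRem_diag_sq_le N

/-- The mean of the squared kernel remainders over the pairs of sample points. -/
lemma lintegral_sum_truncRem_le (h : IsMercerSystem P k κ lam e) (hρ : BoundedDensity P ρ D)
    {Ω : Type*} [MeasurableSpace Ω] {Q : Measure Ω} {n N : ℕ} (hn : 0 < n) (hN : N ≤ n)
    {X : Ω → Fin n → E d} (hX : MeasurePreserving X Q (Measure.pi fun _ => ρ)) :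
    ∫⁻ p, ENNReal.ofReal ((1 / (n : ℝ)) ^ 2 * ∑ i, ∑ j : Fin N,
        truncRem k lam e N (X p (Fin.castLE hN j)) (X p i) ^ 2) ∂Q ≤
      ENNReal.ofReal (N / n * (D ^ 2 * (κ * lam N)) +
        N / n ^ 2 * (D * (κ * ∑' i, lam (i + N)))) := by
  set u := D ^ 2 * (κ * lam N) with hu
  set w := D * (κ * ∑' i, lam (i + N)) with hw
  have hκ := h.bound_nonneg
  have hu0 : 0 ≤ u := by have := (h.lam_pos N).le; positivity
  have hw0 : 0 ≤ w := by
    have : 0 ≤ ∑' i, lam (i + N) := tsum_nonneg fun i => (h.lam_pos _).le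
    positivity
  have hm : ∀ i j, Measurable fun x : Fin n → E d =>
      ENNReal.ofReal (truncRem k lam e N (x i) (x j) ^ 2) := fun i j =>
    ((h.measurable_truncRem_comp N (measurable_pi_apply i)
      (measurable_pi_apply j)).pow_const 2).ennreal_ofReal
  have hterm : ∀ i j : Fin n,
      ∫⁻ p, ENNReal.ofReal (truncRem k lam e N (X p i) (X p j) ^ 2) ∂Q ≤
        ENNReal.ofReal (u + if i = j then w else 0) := by
    intro i j
    rw [hX.lintegral_comp (f := fun x => ENNReal.ofReal (truncRem k lam e N (x i) (x j) ^ 2))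
      (hm i j)]
    split_ifs with hij
    · subst hij
      rw [(measurePreserving_eval (fun _ : Fin n => ρ) i).lintegral_comp
        (f := fun x => ENNReal.ofReal (truncRem k lam e N x x ^ 2))
        ((h.measurable_truncRem_comp N measurable_id measurable_id).pow_const 2).ennreal_ofReal]
      exact (h.lintegral_truncRem_diag_le hρ N).trans
        (ENNReal.ofReal_le_ofReal (by linarith))
    · rw [(measurePreserving_eval_pair ρ hij).lintegral_comp
        (f := fun p => ENNReal.ofReal (truncRem k lam e N p.1 p.2 ^ 2))
        (((h.measurable_truncRem N).pow_const 2).ennreal_ofReal), add_zero]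
      exact h.lintegral_truncRem_prod_le hρ N
  have hsplit : ∀ p, ENNReal.ofReal ((1 / (n : ℝ)) ^ 2 * ∑ i, ∑ j : Fin N,
        truncRem k lam e N (X p (Fin.castLE hN j)) (X p i) ^ 2)
      = ENNReal.ofReal ((1 / (n : ℝ)) ^ 2) * ∑ i, ∑ j : Fin N,
        ENNReal.ofReal (truncRem k lam e N (X p (Fin.castLE hN j)) (X p i) ^ 2) := by
    intro p
    rw [ENNReal.ofReal_mul (by positivity),
      ENNReal.ofReal_sum_of_nonneg fun i _ => Finset.sum_nonneg fun j _ => sq_nonneg _]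
    congr 1
    exact Finset.sum_congr rfl fun i _ => ENNReal.ofReal_sum_of_nonneg fun j _ => sq_nonneg _
  have hm' : ∀ i j, Measurable fun p =>
      ENNReal.ofReal (truncRem k lam e N (X p i) (X p j) ^ 2) := fun i j =>
    (hm i j).comp hX.measurable
  simp only [hsplit]
  rw [lintegral_const_mul _ (Finset.measurable_fun_sum _ fun i _ =>
      Finset.measurable_fun_sum _ fun j _ => hm' _ _),
    lintegral_finsetSum _ fun i _ => Finset.measurable_fun_sum _ fun j _ => hm' _ _]
  simp only [lintegral_finsetSum _ fun j _ => hm' _ _]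
  calc ENNReal.ofReal ((1 / (n : ℝ)) ^ 2) * ∑ i, ∑ j : Fin N,
        ∫⁻ p, ENNReal.ofReal (truncRem k lam e N (X p (Fin.castLE hN j)) (X p i) ^ 2) ∂Q
      ≤ ENNReal.ofReal ((1 / (n : ℝ)) ^ 2) * ∑ i, ∑ j : Fin N,
        ENNReal.ofReal (u + if Fin.castLE hN j = i then w else 0) := by
        gcongr with i _ j _
        exact hterm _ _
    _ = ENNReal.ofReal ((1 / (n : ℝ)) ^ 2 * ∑ i, ∑ j : Fin N,
        (u + if Fin.castLE hN j = i then w else 0)) := by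
        have hnn : ∀ (i : Fin n) (j : Fin N), 0 ≤ u + if Fin.castLE hN j = i then w else 0 := by
          intro i j
          split_ifs <;> positivity
        rw [ENNReal.ofReal_mul (by positivity),
          ENNReal.ofReal_sum_of_nonneg fun i _ => Finset.sum_nonneg fun j _ => hnn i j]
        congr 1
        exact Finset.sum_congr rfl fun i _ =>
          (ENNReal.ofReal_sum_of_nonneg fun j _ => hnn i j).symm
    -- There are `N * n` pairs in all, of which only `N` lie on the diagonal.
    _ = ENNReal.ofReal (N / n * u + N / n ^ 2 * w) := by
        congr 1
        rw [Finset.sum_comm]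
        simp only [Finset.sum_add_distrib, Finset.sum_const, Finset.card_univ, Fintype.card_fin,
          nsmul_eq_mul, Finset.sum_ite_eq, Finset.mem_univ, if_true]
        have : (n : ℝ) ≠ 0 := by positivity
        field_simp

/-- The squared `L²(P)` distance of a function of the RKHS to its spectral projection. -/
lemma integral_sub_sum_sq_le (h : IsMercerSystem P k κ lam e) {f : E d → ℝ} (hf : MemLp f 2 P)
    (hs : Summable fun i => (∫ x, f x * e i x ∂P) ^ 2 / lam i) (N : ℕ) :
    ∫ x, (f x - ∑ m ∈ Finset.range N, (∫ x, f x * e m x ∂P) * e m x) ^ 2 ∂P ≤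
      lam N * ∑' i, (∫ x, f x * e i x ∂P) ^ 2 / lam i := by
  have hg : MemLp (fun x => f x - ∑ m ∈ Finset.range N, (∫ x, f x * e m x ∂P) * e m x) 2 P :=
    hf.sub (memLp_finsetSum _ fun m _ => (h.memLp m).const_mul _)
  have h1 := h.hasSum_mul _ _ hg hg
  simp only [h.integral_sub_sum_mul hf N fun m => ∫ x, f x * e m x ∂P] at h1
  simp only [sq (f _ - _)]
  refine hasSum_le (fun i => ?_) h1 (hs.hasSum.mul_left (lam N))
  have hi := h.lam_pos i
  split_ifs with hiN
  · rw [sub_self, mul_zero]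
    exact mul_nonneg (h.lam_pos N).le (by positivity)
  · have h3 : lam i ≤ lam N := h.antitone (not_lt.1 hiN)
    rw [sub_zero, ← sq]
    calc (∫ x, f x * e i x ∂P) ^ 2 = lam i * ((∫ x, f x * e i x ∂P) ^ 2 / lam i) := by
          field_simp
      _ ≤ _ := by gcongr

end IsMercerSystem

/-- The risk of the estimator in terms of the eigenvalues of the kernel operator. -/
lemma risk_le {S : Set (E d)} {K : E d → E d → ℝ} (hPS : P Sᶜ = 0) (hK : IsMercerKernel S K)
    {lam : ℕ → ℝ} {φ : ℕ → E d → ℝ} {κ : ℝ}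
    (h : IsMercerSystem P (restrictKernel S K) κ lam fun i => S.indicator (φ i))
    (hρ : BoundedDensity P ρ D) {ν : Measure ℝ} {σ : ℝ} (hν : IsNoiseLaw ν σ)
    {f : E d → ℝ} {R : ℝ} (hf : MemRKHS P lam φ f) (hR : rkhsNormSq P lam φ f ≤ R ^ 2)
    {n N : ℕ} (hn : 0 < n) (hN : N ≤ n) {α : ℝ} (hα : 0 < α) {G : Set (Fin n → E d)}
    (hG : MeasurableSet G)
    (hGb : ∀ᵐ x ∂(Measure.pi fun _ : Fin n => ρ), x ∈ G → BoundedCoeffs S P K lam φ f hN x) :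
    risk ρ ν K f hN α G ≤ ENNReal.ofReal (2 * α + 4 * (D * (lam N * R ^ 2)) +
      4 * (N / n * (D ^ 2 * (κ * lam N)) + N / n ^ 2 * (D * (κ * ∑' i, lam (i + N)))) +
      2 * (σ ^ 2 * N / n)) := by
  have := hν.prob
  set Q := (Measure.pi fun _ : Fin n => ρ).prod (Measure.pi fun _ : Fin n => ν) with hQ
  have hfst : MeasurePreserving Prod.fst Q (Measure.pi fun _ : Fin n => ρ) :=
    measurePreserving_fst
  have heval : ∀ i, MeasurePreserving (fun p : (Fin n → E d) × (Fin n → ℝ) => p.1 i) Q ρ :=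
    fun i => (measurePreserving_eval (fun _ : Fin n => ρ) i).comp hfst
  have hind : ∀ i, S.indicator (φ i) =ᵐ[P] φ i := by
    intro i
    filter_upwards [ae_mem_of_measure_compl hPS] with x hx
    exact Set.indicator_of_mem hx _
  have hcoeff : ∀ i, ∫ x, f x * S.indicator (φ i) x ∂P = coeff P φ f i := by
    intro i
    refine integral_congr_ae ?_
    filter_upwards [hind i] with x hx
    rw [hx]
  set g : E d → ℝ := fun x =>
    f x - ∑ m ∈ Finset.range N, coeff P φ f m * S.indicator (φ m) x with hg
  have hgL : MemLp g 2 P :=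
    hf.1.sub (memLp_finsetSum _ fun m _ => (h.memLp m).const_mul _)
  have hg2 : ∫⁻ x, ENNReal.ofReal (g x ^ 2) ∂ρ ≤ ENNReal.ofReal (D * (lam N * R ^ 2)) := by
    have h1 := h.integral_sub_sum_sq_le hf.1 (by simpa only [hcoeff] using hf.2) N
    simp only [hcoeff] at h1
    refine (hρ.lintegral_le _).trans ?_
    rw [← ofReal_integral_eq_lintegral_ofReal hgL.integrable_sq
      (Filter.Eventually.of_forall fun _ => sq_nonneg _), ENNReal.ofReal_mul D.coe_nonneg,
      ENNReal.ofReal_coe_nnreal]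
    gcongr
    exact h1.trans (mul_le_mul_of_nonneg_left hR (h.lam_pos N).le)
  have hgm : AEMeasurable (fun x => ENNReal.ofReal (g x ^ 2)) ρ :=
    (hgL.1.aemeasurable.mono_ac hρ.1).pow_const 2 |>.ennreal_ofReal
  have hgm' : ∀ i, AEMeasurable (fun p : (Fin n → E d) × (Fin n → ℝ) =>
      ENNReal.ofReal (g (p.1 i) ^ 2)) Q := fun i =>
    hgm.comp_quasiMeasurePreserving (heval i).quasiMeasurePreserving
  set b₁ : (Fin n → E d) × (Fin n → ℝ) → ℝ := fun p => sqNorm n fun i => g (p.1 i) with hb₁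
  have hb₁e : ∀ p, ENNReal.ofReal (b₁ p)
      = ENNReal.ofReal (1 / n) * ∑ i, ENNReal.ofReal (g (p.1 i) ^ 2) := by
    intro p
    rw [← ENNReal.ofReal_sum_of_nonneg fun i _ => sq_nonneg _,
      ← ENNReal.ofReal_mul (by positivity)]
    rfl
  have hb₁m : AEMeasurable (fun p => ENNReal.ofReal (b₁ p)) Q := by
    simp only [hb₁e]
    exact (Finset.aemeasurable_fun_sum _ fun i _ => hgm' i).const_mul _
  have hb₁i : ∫⁻ p, ENNReal.ofReal (b₁ p) ∂Q ≤ ENNReal.ofReal (D * (lam N * R ^ 2)) := by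
    simp only [hb₁e]
    rw [lintegral_const_mul'' _ (Finset.aemeasurable_fun_sum _ fun i _ => hgm' i),
      lintegral_finsetSum' _ fun i _ => hgm' i]
    simp only [fun i => (heval i).lintegral_comp_aemeasurable hgm]
    rw [Finset.sum_const, Finset.card_univ, Fintype.card_fin, nsmul_eq_mul, ← mul_assoc]
    have : ENNReal.ofReal (1 / n) * n = 1 := by
      rw [← ENNReal.ofReal_natCast, ← ENNReal.ofReal_mul (by positivity)]
      have : (n : ℝ) ≠ 0 := by positivity
      simp [this]
    rw [this, one_mul]
    exact hg2
  set b₂ : (Fin n → E d) × (Fin n → ℝ) → ℝ := fun p => (1 / (n : ℝ)) ^ 2 * ∑ i, ∑ j : Fin N,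
    truncRem (restrictKernel S K) lam (fun m => S.indicator (φ m)) N
      (p.1 (Fin.castLE hN j)) (p.1 i) ^ 2 with hb₂
  have hb₂m : Measurable b₂ := by
    refine (Finset.measurable_fun_sum _ fun i _ => Finset.measurable_fun_sum _ fun j _ => ?_).const_mul _
    exact (h.measurable_truncRem_comp N (heval _).measurable (heval _).measurable).pow_const 2
  have hb₂i := h.lintegral_sum_truncRem_le hρ hn hN hfst
  have hgram : ∀ i j, Measurable fun x : Fin n → E d => gram (restrictKernel S K) hN x i j := by
    intro i j
    have hij : Measurable fun x : Fin n → E d => (x i, x (Fin.castLE hN j)) :=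
      (measurable_pi_apply i).prodMk (measurable_pi_apply _)
    exact (h.measurable_kernel.comp hij).const_mul _
  set v : (Fin n → E d) × (Fin n → ℝ) → ℝ := fun p =>
    sqNorm n (hatMatrix (gram (restrictKernel S K) hN p.1) α *ᵥ p.2) with hv
  have hvi := hν.lintegral_hatMatrix_le (Measure.pi fun _ : Fin n => ρ) hgram hα
  have hS : ∀ᵐ p ∂Q, ∀ i, p.1 i ∈ S := by
    rw [ae_all_iff]
    exact fun i => (heval i).quasiMeasurePreserving.ae
      (hρ.1.ae_le (ae_mem_of_measure_compl hPS))
  -- The coefficients 2, 4, 4, 2 come from splitting off the noise at the price of a factor 2, and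
  -- then doubling the bias bound. Only this step needs the sample in `G`.
  have hpt : ∀ᵐ (p : (Fin n → E d) × (Fin n → ℝ)) ∂Q, p ∈ Prod.fst ⁻¹' G →
      ENNReal.ofReal (sqNorm n fun i =>
        tkrr K hN α p.1 (fun k => f (p.1 k) + p.2 k) (p.1 i) - f (p.1 i)) ≤
      ENNReal.ofReal (2 * α) + (4 * ENNReal.ofReal (b₁ p) + (4 * ENNReal.ofReal (b₂ p) +
        2 * ENNReal.ofReal (v p))) := by
    filter_upwards [hS, hfst.quasiMeasurePreserving.ae hGb] with p hpS hpb hpG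
    have h1 := sqNorm_bias_le hK hN hα hpS (hpb hpG)
    have h2 : ∀ i, tkrr K hN α p.1 (fun k => f (p.1 k) + p.2 k) (p.1 i) - f (p.1 i)
        = ((hatMatrix (gram K hN p.1) α *ᵥ fun k => f (p.1 k)) i - f (p.1 i))
          + (hatMatrix (gram K hN p.1) α *ᵥ p.2) i := by
      intro i
      rw [tkrr_apply_sample hK hN α hpS]
      have : (fun k => f (p.1 k) + p.2 k) = (fun k => f (p.1 k)) + p.2 := rfl
      rw [this, Matrix.mulVec_add, Pi.add_apply]
      ring
    have h3 : (sqNorm n fun i => f (p.1 i) - projN P φ N f (p.1 i)) = b₁ p := by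
      simp only [hb₁, hg, projN]
      congr 1
      funext i
      congr 1
      exact Finset.sum_congr rfl fun m _ => by rw [Set.indicator_of_mem (hpS i)]
    have h4 : sqNorm n (hatMatrix (gram K hN p.1) α *ᵥ p.2) = v p := by
      simp only [hv, gram_restrictKernel hN hpS]
    have h5 := sqNorm_add_le n
      (fun i => (hatMatrix (gram K hN p.1) α *ᵥ fun k => f (p.1 k)) i - f (p.1 i))
      (hatMatrix (gram K hN p.1) α *ᵥ p.2)
    simp only [h2]
    have hb10 : 0 ≤ b₁ p := sqNorm_nonneg _ _
    have hb20 : 0 ≤ b₂ p := by simp only [hb₂]; positivity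
    have hv0 : 0 ≤ v p := sqNorm_nonneg _ _
    have e4 : (4 : ℝ≥0∞) = ENNReal.ofReal 4 := by simp
    have e2 : (2 : ℝ≥0∞) = ENNReal.ofReal 2 := by simp
    rw [e4, e2, ← ENNReal.ofReal_mul (by norm_num), ← ENNReal.ofReal_mul (by norm_num),
      ← ENNReal.ofReal_mul (by norm_num), ← ENNReal.ofReal_add (by positivity) (by positivity),
      ← ENNReal.ofReal_add (by positivity) (by positivity),
      ← ENNReal.ofReal_add (by positivity) (by positivity)]
    refine ENNReal.ofReal_le_ofReal ?_
    rw [h3] at h1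
    rw [h4] at h5
    change _ ≤ α + 2 * b₁ p + 2 * b₂ p at h1
    linarith
  have hκ := h.bound_nonneg
  have hlN := (h.lam_pos N).le
  have hτ : 0 ≤ ∑' i, lam (i + N) := tsum_nonneg fun i => (h.lam_pos _).le
  calc risk ρ ν K f hN α G ≤ ∫⁻ p in Prod.fst ⁻¹' G, ENNReal.ofReal (2 * α) +
        (4 * ENNReal.ofReal (b₁ p) + (4 * ENNReal.ofReal (b₂ p) + 2 * ENNReal.ofReal (v p))) ∂Q :=
        setLIntegral_mono_ae' (measurable_fst hG) hpt
    _ ≤ ∫⁻ p, ENNReal.ofReal (2 * α) +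
        (4 * ENNReal.ofReal (b₁ p) + (4 * ENNReal.ofReal (b₂ p) + 2 * ENNReal.ofReal (v p))) ∂Q :=
        setLIntegral_le_lintegral _ _
    _ = ENNReal.ofReal (2 * α) + (4 * ∫⁻ p, ENNReal.ofReal (b₁ p) ∂Q +
        (4 * ∫⁻ p, ENNReal.ofReal (b₂ p) ∂Q + 2 * ∫⁻ p, ENNReal.ofReal (v p) ∂Q)) := by
        rw [lintegral_add_left measurable_const, lintegral_add_left' (hb₁m.const_mul _),
          lintegral_add_left (hb₂m.ennreal_ofReal.const_mul _), lintegral_const,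
          lintegral_const_mul'' _ hb₁m, lintegral_const_mul _ hb₂m.ennreal_ofReal,
          lintegral_const_mul' _ _ (by simp), measure_univ, mul_one]
    _ ≤ ENNReal.ofReal (2 * α) + (4 * ENNReal.ofReal (D * (lam N * R ^ 2)) +
        (4 * ENNReal.ofReal (N / n * (D ^ 2 * (κ * lam N)) +
          N / n ^ 2 * (D * (κ * ∑' i, lam (i + N)))) + 2 * ENNReal.ofReal (σ ^ 2 * N / n))) := by
        gcongr
    _ = _ := by
        have e4 : (4 : ℝ≥0∞) = ENNReal.ofReal 4 := by simp
        have e2 : (2 : ℝ≥0∞) = ENNReal.ofReal 2 := by simp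
        rw [e4, e2, ← ENNReal.ofReal_mul (by norm_num), ← ENNReal.ofReal_mul (by norm_num),
          ← ENNReal.ofReal_mul (by norm_num), ← ENNReal.ofReal_add (by positivity) (by positivity),
          ← ENNReal.ofReal_add (by positivity) (by positivity),
          ← ENNReal.ofReal_add (by positivity) (by positivity)]
        congr 1
        ring

end Sampling

end TKRR

namespace TKRR

/-! ### Tails of exponentially and polynomially decaying eigenvalues. -/

section Tails

variable {lam : ℕ → ℝ} {N : ℕ}

lemma tsum_tail_le_of_exp {b c : ℝ} (hb : 0 < b) (hc : 0 ≤ c) (hs : Summable lam)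
    (h : ∀ i, lam (i + N) ≤ c * Real.exp (-(b * ((i + N : ℕ) + 1 : ℝ)))) :
    ∑' i, lam (i + N) ≤ c * Real.exp (-(b * N)) / b := by
  set x := Real.exp (-b) with hx
  have hx0 : 0 < x := Real.exp_pos _
  have hx1 : x < 1 := by rw [hx, Real.exp_lt_one_iff]; linarith
  have hg := (hasSum_geometric_of_lt_one hx0.le hx1).mul_left (c * Real.exp (-(b * N)) * x)
  have h1 : ∑' i, lam (i + N) ≤ c * Real.exp (-(b * N)) * x * (1 - x)⁻¹ := by
    refine hasSum_le (fun i => ?_) ((summable_nat_add_iff N).2 hs).hasSum hg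
    refine (h i).trans_eq ?_
    rw [hx, ← Real.exp_nat_mul, mul_assoc (c * _), mul_assoc c, ← Real.exp_add, ← Real.exp_add]
    push_cast
    ring_nf
  refine h1.trans ?_
  -- With `x = exp (-b)` the left side is `1 / (exp b - 1)`.
  have h2 : x * (1 - x)⁻¹ ≤ 1 / b := by
    rw [← div_eq_mul_inv, div_le_div_iff₀ (by linarith) hb]
    have h3 : b + 1 ≤ Real.exp b := Real.add_one_le_exp b
    have h4 : x * Real.exp b = 1 := by rw [hx, ← Real.exp_add]; simp
    nlinarith
  calc c * Real.exp (-(b * N)) * x * (1 - x)⁻¹ = c * Real.exp (-(b * N)) * (x * (1 - x)⁻¹) := by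
        ring
    _ ≤ c * Real.exp (-(b * N)) * (1 / b) := by gcongr
    _ = _ := by ring

lemma one_add_mul_le_rpow_of_nonpos {x y : ℝ} (hx : 0 < x) (hy : y ≤ 0) :
    1 + y * (x - 1) ≤ x ^ y := by
  rw [Real.rpow_def_of_pos hx]
  have h1 := Real.log_le_sub_one_of_pos hx
  have h2 := Real.add_one_le_exp (Real.log x * y)
  nlinarith

/-- The right side is the integral of `t ^ (-p)` over `[m, m + 1]`. The comparison follows from
Bernoulli's inequality with the negative exponent `1 - p`, and it makes the tail sum telescope. -/
lemma rpow_neg_le_sub {p m : ℝ} (hp : 1 < p) (hm : 0 < m) :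
    (m + 1) ^ (-p) ≤ (m ^ (1 - p) - (m + 1) ^ (1 - p)) / (p - 1) := by
  have hm1 : 0 < m + 1 := by linarith
  rw [le_div_iff₀ (by linarith)]
  have h1 := one_add_mul_le_rpow_of_nonpos (x := m / (m + 1)) (y := 1 - p) (by positivity)
    (by linarith)
  rw [Real.div_rpow hm.le hm1.le, le_div_iff₀ (by positivity)] at h1
  have h2 : (m + 1) ^ (1 - p) = (m + 1) ^ (-p) * (m + 1) := by
    rw [← Real.rpow_add_one hm1.ne']
    ring_nf
  have h3 : (1 + (1 - p) * (m / (m + 1) - 1)) * (m + 1) ^ (1 - p)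
      = (m + 1) ^ (1 - p) + (p - 1) * (m + 1) ^ (-p) := by
    rw [h2]
    field_simp
    ring
  rw [h3] at h1
  linarith

lemma tsum_tail_le_of_rpow {p c : ℝ} (hp : 1 < p) (hc : 0 ≤ c) (hN : 1 ≤ N)
    (hnn : ∀ i, 0 ≤ lam i) (h : ∀ i, lam (i + N) ≤ c * (((i + N : ℕ) : ℝ) + 1) ^ (-p)) :
    ∑' i, lam (i + N) ≤ c * ((N : ℝ) ^ (1 - p) / (p - 1)) := by
  refine Real.tsum_le_of_sum_range_le (fun i => hnn _) fun n => ?_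
  have h1 : ∑ i ∈ Finset.range n, lam (i + N) ≤
      c * (((N : ℝ) ^ (1 - p) - ((n + N : ℕ) : ℝ) ^ (1 - p)) / (p - 1)) := by
    induction n with
    | zero => simp
    | succ n ih =>
      rw [Finset.sum_range_succ]
      have h2 := rpow_neg_le_sub (m := ((n + N : ℕ) : ℝ)) hp (by positivity)
      have h3 := (h n).trans (mul_le_mul_of_nonneg_left h2 hc)
      have h4 : ((n + N : ℕ) : ℝ) + 1 = ((n + 1 + N : ℕ) : ℝ) := by push_cast; ring
      rw [h4] at h3
      refine (add_le_add ih h3).trans_eq ?_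
      ring
  refine h1.trans ?_
  have : 0 < p - 1 := by linarith
  gcongr
  have : 0 ≤ ((n + N : ℕ) : ℝ) ^ (1 - p) := by positivity
  linarith

end Tails

/-! ### Comparison with the rates. -/

section Rates

lemma natCeil_le_two_mul_max {y : ℝ} {m : ℕ} (hm : 1 ≤ m) :
    ((max m ⌈y⌉₊ : ℕ) : ℝ) ≤ 2 * max (m : ℝ) y := by
  have hm' : (1 : ℝ) ≤ m := by exact_mod_cast hm
  have h1 := le_max_left (m : ℝ) y
  have h2 := le_max_right (m : ℝ) y
  rw [Nat.cast_max]
  refine max_le (by linarith) ?_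
  rcases le_or_gt y 0 with hy | hy
  · rw [Nat.ceil_eq_zero.2 hy, Nat.cast_zero]
    linarith
  · have := Nat.ceil_lt_add_one hy.le
    linarith

/-- In this form the rate is `σ ^ 2 / n` times the truncation order before rounding, so the variance
term is at most twice the rate. -/
lemma expRate_eq {b : ℝ} {Nb n : ℕ} {σ : ℝ} (hn : 0 < n) (hb : 0 < b) :
    expRate b Nb n σ = σ ^ 2 / n * max (Nb : ℝ) (1 / b * Real.log (n / σ ^ 2)) := by
  have hn' : (0 : ℝ) < n := by exact_mod_cast hn
  have h1 : 1 / (b * n) * Real.log (n / σ ^ 2) = (1 / b * Real.log (n / σ ^ 2)) / n := by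
    field_simp
  rw [expRate, h1, max_div_div_right hn'.le]
  ring

lemma polyRate_eq {s γ : ℝ} {Ns n : ℕ} {σ : ℝ} (hn : 0 < n) (hσ : 0 < σ) (hq : 2 * s + γ ≠ 0) :
    polyRate s γ Ns n σ
      = σ ^ 2 / n * max (Ns : ℝ) (((n : ℝ) / σ ^ 2) ^ (1 / (2 * s + γ))) := by
  have hn' : (0 : ℝ) < n := by exact_mod_cast hn
  have ht : 0 < (n : ℝ) / σ ^ 2 := by positivity
  rw [mul_max_of_nonneg _ _ (by positivity), polyRate]
  congr 1
  · ring
  · have h1 : σ ^ 2 / (n : ℝ) = ((n : ℝ) / σ ^ 2) ^ (-1 : ℝ) := by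
      rw [Real.rpow_neg_one, inv_div]
    rw [h1, ← Real.rpow_add ht]
    congr 1
    field_simp
    ring

variable {d : ℕ} {P : Measure (E d)} [IsProbabilityMeasure P]

/-- A risk bound from bounds on the variance term, on the first neglected eigenvalue and on the
tail of the eigenvalues. -/
lemma riskBound_of_le {S : Set (E d)} {K : E d → E d → ℝ} (hPS : P Sᶜ = 0)
    (hK : IsMercerKernel S K) {lam : ℕ → ℝ} {φ : ℕ → E d → ℝ} {κ : ℝ}
    (h : IsMercerSystem P (restrictKernel S K) κ lam fun i => S.indicator (φ i))
    {D : ℝ≥0} {R A : ℝ} {order : ℕ → ℝ → ℕ} {rate : ℕ → ℝ → ℝ} {B₁ B₂ B₃ C : ℝ}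
    (hord : ∀ n σ, 1 ≤ order n σ)
    (hC : 2 * (|A| + 1) * B₁ + 4 * (D * R ^ 2 + D ^ 2 * κ) * B₂ + 4 * (D * κ) * B₃ ≤ C)
    (hrate : ∀ (n : ℕ) (σ : ℝ), 0 < n → 0 < σ → order n σ ≤ n → 0 ≤ rate n σ ∧
      σ ^ 2 / n * order n σ ≤ B₁ * rate n σ ∧ lam (order n σ) ≤ B₂ * rate n σ ∧
      (order n σ : ℝ) / n ^ 2 * ∑' i, lam (i + order n σ) ≤ B₃ * rate n σ) :
    RiskBound S P K lam φ D R A order rate C := by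
  intro ρ hρp hρ ν σ hσ hν f hf hR n N hN hNo α hα hαA G hG hGb
  have hN1 : 1 ≤ N := hNo ▸ hord n σ
  have hn : 0 < n := by omega
  obtain ⟨h0, h1, h2, h3⟩ := hrate n σ hn hσ (hNo ▸ hN)
  rw [← hNo] at h1 h2 h3
  refine (risk_le hPS hK h hρ hν hf hR hn hN hα hG (hGb.mono fun x hx hxG => (hx hxG).2)).trans
    (ENNReal.ofReal_le_ofReal ?_)
  set r := rate n σ
  set τ := ∑' i, lam (i + N)
  have hκ := h.bound_nonneg
  have hD : (0 : ℝ) ≤ D := D.coe_nonneg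
  have hlN := (h.lam_pos N).le
  have hn' : (0 : ℝ) < n := by exact_mod_cast hn
  have hNn : (N : ℝ) / n ≤ 1 := by
    rw [div_le_one hn']
    exact_mod_cast hN
  have hV : σ ^ 2 * N / n = σ ^ 2 / n * N := by ring
  have hα' : α ≤ |A| * (B₁ * r) := by
    rw [hV] at hαA
    have h4 : A * (σ ^ 2 / n * N) ≤ |A| * (σ ^ 2 / n * N) := by
      gcongr
      exact le_abs_self A
    exact (hαA.trans h4).trans (by gcongr)
  have h5 : N / n * (D ^ 2 * (κ * lam N)) ≤ D ^ 2 * (κ * (B₂ * r)) := by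
    calc N / n * (D ^ 2 * (κ * lam N)) ≤ 1 * (D ^ 2 * (κ * lam N)) := by gcongr
      _ ≤ D ^ 2 * (κ * (B₂ * r)) := by rw [one_mul]; gcongr
  have h6 : N / n ^ 2 * (D * (κ * τ)) ≤ D * κ * (B₃ * r) := by
    calc N / n ^ 2 * (D * (κ * τ)) = D * κ * (N / n ^ 2 * τ) := by ring
      _ ≤ _ := by gcongr
  have h7 : D * (lam N * R ^ 2) ≤ D * (B₂ * r * R ^ 2) := by gcongr
  rw [hV]
  calc _ ≤ 2 * (|A| * (B₁ * r)) + 4 * (D * (B₂ * r * R ^ 2)) +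
        4 * (D ^ 2 * (κ * (B₂ * r)) + D * κ * (B₃ * r)) + 2 * (B₁ * r) := by gcongr
    _ = (2 * (|A| + 1) * B₁ + 4 * (D * R ^ 2 + D ^ 2 * κ) * B₂ + 4 * (D * κ) * B₃) * r := by ring
    _ ≤ C * r := by gcongr

variable {k : E d → E d → ℝ} {κ : ℝ} {lam : ℕ → ℝ} {e : ℕ → E d → ℝ}

/-- The order is chosen so that `exp (-(b * N)) ≤ σ ^ 2 / n`. The constants must not depend on `b`,
although the tail sum carries a factor `1 / b`. -/
lemma IsMercerSystem.exp_bounds (h : IsMercerSystem P k κ lam e) {b c : ℝ} (hb : 0 < b)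
    {Nb : ℕ} (hNb : 1 ≤ Nb)
    (hlam : ∀ i : ℕ, Nb ≤ i + 1 → lam i ≤ c * Real.exp (-(b * ((i : ℝ) + 1)))) {n : ℕ} {σ : ℝ}
    (hn : 0 < n) (hσ : 0 < σ) (hN : expOrder b Nb n σ ≤ n) :
    0 ≤ expRate b Nb n σ ∧ σ ^ 2 / n * expOrder b Nb n σ ≤ 2 * expRate b Nb n σ ∧
      lam (expOrder b Nb n σ) ≤ |c| * expRate b Nb n σ ∧
      (expOrder b Nb n σ : ℝ) / n ^ 2 * ∑' i, lam (i + expOrder b Nb n σ) ≤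
        (|c| + 3 * κ) * expRate b Nb n σ := by
  have hκ := h.bound_nonneg
  have hn' : (0 : ℝ) < n := by exact_mod_cast hn
  have hn1 : (1 : ℝ) ≤ n := by exact_mod_cast hn
  have hceil := natCeil_le_two_mul_max (y := 1 / b * Real.log (n / σ ^ 2)) hNb
  have hNbN : Nb ≤ expOrder b Nb n σ := le_max_left _ _
  have hLN : 1 / b * Real.log (n / σ ^ 2) ≤ expOrder b Nb n σ :=
    (Nat.le_ceil _).trans (by exact_mod_cast le_max_right _ _)
  rw [expRate_eq hn hb]
  set m := max (Nb : ℝ) (1 / b * Real.log (n / σ ^ 2)) with hm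
  rw [show max Nb ⌈1 / b * Real.log (n / σ ^ 2)⌉₊ = expOrder b Nb n σ from rfl] at hceil
  set N := expOrder b Nb n σ
  set L := Real.log (n / σ ^ 2) with hL
  have hm1 : 1 ≤ m := le_trans (by exact_mod_cast hNb) (le_max_left _ _)
  have hv : 0 < σ ^ 2 / n := by positivity
  have hvm : σ ^ 2 / n ≤ σ ^ 2 / n * m := le_mul_of_one_le_right hv.le hm1
  have hLbN : L ≤ b * N := by
    rw [one_div, inv_mul_le_iff₀ hb] at hLN
    exact hLN
  have hexp : Real.exp (-(b * N)) ≤ σ ^ 2 / n := by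
    calc Real.exp (-(b * N)) ≤ Real.exp (-L) := Real.exp_le_exp.2 (by linarith)
      _ = σ ^ 2 / n := by rw [Real.exp_neg, hL, Real.exp_log (by positivity), inv_div]
  have hNn : (N : ℝ) ≤ n := by exact_mod_cast hN
  -- With indices from zero, `lam (i + N)` is eigenvalue number `i + N + 1`, beyond the threshold
  -- `Nb`.
  have hlam' : ∀ i, lam (i + N) ≤ |c| * Real.exp (-(b * ((i + N : ℕ) + 1 : ℝ))) := fun i =>
    (hlam (i + N) (by omega)).trans (by gcongr; exact le_abs_self c)
  have hτ0 : 0 ≤ ∑' i, lam (i + N) := tsum_nonneg fun i => (h.lam_pos _).le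
  have hNn2 : (N : ℝ) / n ^ 2 ≤ 1 / n := by
    rw [div_le_div_iff₀ (by positivity) hn']
    nlinarith
  refine ⟨by positivity, ?_, ?_, ?_⟩
  · nlinarith [mul_le_mul_of_nonneg_left hceil hv.le]
  · have h1 := hlam' 0
    rw [zero_add] at h1
    calc lam N ≤ |c| * Real.exp (-(b * (N + 1))) := h1
      _ ≤ |c| * Real.exp (-(b * N)) := by gcongr; linarith
      _ ≤ |c| * (σ ^ 2 / n * m) := by gcongr; exact hexp.trans hvm
  -- If `L ≥ 1`, then `1 ≤ L ≤ b * N ≤ b * n`, and the weight `1 / n` absorbs `1 / b`. If `L < 1`,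
  -- then `n / σ ^ 2 < e < 3`, the rate is at least `1 / 3`, and the trace bound `κ` suffices.
  · rcases le_or_gt 1 L with hL1 | hL1
    · have h1 := tsum_tail_le_of_exp hb (abs_nonneg c) h.summable_lam hlam'
      have h2 : 1 ≤ b * n := hL1.trans (hLbN.trans (by gcongr))
      calc (N : ℝ) / n ^ 2 * ∑' i, lam (i + N)
          ≤ 1 / n * (|c| * Real.exp (-(b * N)) / b) := by gcongr
        _ = |c| * Real.exp (-(b * N)) / (b * n) := by field_simp
        _ ≤ |c| * Real.exp (-(b * N)) := div_le_self (by positivity) h2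
        _ ≤ |c| * (σ ^ 2 / n * m) := by gcongr; exact hexp.trans hvm
        _ ≤ (|c| + 3 * κ) * (σ ^ 2 / n * m) := by gcongr; linarith
    · have h1 : (n : ℝ) / σ ^ 2 ≤ 3 := by
        have h2 := (Real.log_lt_iff_lt_exp (by positivity)).1 hL1
        have h3 := Real.exp_one_lt_d9
        linarith
      have h4 : 1 ≤ 3 * (σ ^ 2 / n) := by
        rw [div_le_iff₀ (by positivity)] at h1
        rw [← mul_div_assoc, le_div_iff₀ hn']
        linarith
      calc (N : ℝ) / n ^ 2 * ∑' i, lam (i + N) ≤ 1 / n * κ := by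
            gcongr
            exact h.tsum_lam_le N
        _ ≤ 1 * κ := by
            gcongr
            rw [div_le_one hn']
            exact hn1
        _ ≤ 3 * (σ ^ 2 / n * m) * κ := by
            gcongr
            linarith
        _ ≤ (|c| + 3 * κ) * (σ ^ 2 / n * m) := by
            have : 0 ≤ |c| * (σ ^ 2 / n * m) := by positivity
            linarith

/-- Both the neglected eigenvalue and the weighted tail reduce to `N ^ (-(2 * s))`, which the rate
dominates because `γ ≤ 1`. -/
lemma IsMercerSystem.poly_bounds (h : IsMercerSystem P k κ lam e) {s γ c : ℝ} (hs : 0 < s)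
    (hq : 0 < 2 * s + γ) (hγ : γ ≤ 1) {Ns : ℕ} (hNs : 1 ≤ Ns)
    (hlam : ∀ i : ℕ, Ns ≤ i + 1 → lam i ≤ c * ((i : ℝ) + 1) ^ (-(2 * s))) {n : ℕ} {σ : ℝ}
    (hn : 0 < n) (hσ : 0 < σ) (hN : polyOrder s γ Ns n σ ≤ n) :
    0 ≤ polyRate s γ Ns n σ ∧ σ ^ 2 / n * polyOrder s γ Ns n σ ≤ 2 * polyRate s γ Ns n σ ∧
      lam (polyOrder s γ Ns n σ) ≤ |c| * polyRate s γ Ns n σ ∧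
      (polyOrder s γ Ns n σ : ℝ) / n ^ 2 * ∑' i, lam (i + polyOrder s γ Ns n σ) ≤
        (|c| / |2 * s - 1| + κ) * polyRate s γ Ns n σ := by
  have hκ := h.bound_nonneg
  have hn' : (0 : ℝ) < n := by exact_mod_cast hn
  set t := (n : ℝ) / σ ^ 2 with ht
  have ht0 : 0 < t := by positivity
  have hceil := natCeil_le_two_mul_max (y := t ^ (1 / (2 * s + γ))) hNs
  rw [show max Ns ⌈t ^ (1 / (2 * s + γ))⌉₊ = polyOrder s γ Ns n σ from rfl] at hceil
  have hNsN : Ns ≤ polyOrder s γ Ns n σ := le_max_left _ _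
  have htN : t ^ (1 / (2 * s + γ)) ≤ polyOrder s γ Ns n σ :=
    (Nat.le_ceil _).trans (by exact_mod_cast le_max_right _ _)
  have hr := polyRate_eq (Ns := Ns) hn hσ hq.ne'
  have hr1 : σ ^ 2 * (Ns : ℝ) / n ≤ polyRate s γ Ns n σ := le_max_left _ _
  have hr2 : t ^ (-((2 * s + γ - 1) / (2 * s + γ))) ≤ polyRate s γ Ns n σ := le_max_right _ _
  set N := polyOrder s γ Ns n σ
  set r := polyRate s γ Ns n σ
  have hr0 : 0 ≤ r := le_trans (by positivity) hr1
  have hN1 : (1 : ℝ) ≤ N := by exact_mod_cast hNs.trans hNsN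
  have hN0 : (0 : ℝ) < N := by linarith
  have hNn : (N : ℝ) ≤ n := by exact_mod_cast hN
  have hv : 0 < σ ^ 2 / n := by positivity
  have hNr : (N : ℝ) ^ (-(2 * s)) ≤ r := by
    rcases le_or_gt 1 t with ht1 | ht1
    · calc (N : ℝ) ^ (-(2 * s)) ≤ (t ^ (1 / (2 * s + γ))) ^ (-(2 * s)) :=
            Real.rpow_le_rpow_of_nonpos (by positivity) htN (by linarith)
        _ = t ^ (1 / (2 * s + γ) * -(2 * s)) := (Real.rpow_mul ht0.le _ _).symm
        _ ≤ t ^ (-((2 * s + γ - 1) / (2 * s + γ))) := by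
            refine Real.rpow_le_rpow_of_exponent_le ht1 ?_
            rw [one_div_mul_eq_div, ← neg_div]
            gcongr
            linarith
        _ ≤ r := hr2
    -- For `t < 1` the exponents compare the wrong way, but the first entry of the rate already
    -- exceeds `1`.
    · have h1 : 1 ≤ σ ^ 2 * (Ns : ℝ) / n := by
        have h2 : (1 : ℝ) ≤ Ns := by exact_mod_cast hNs
        rw [ht, div_lt_one (by positivity)] at ht1
        rw [le_div_iff₀ hn']
        nlinarith [sq_nonneg σ]
      exact (Real.rpow_le_one_of_one_le_of_nonpos hN1 (by linarith)).trans (h1.trans hr1)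
  have hlam' : ∀ i, lam (i + N) ≤ |c| * (((i + N : ℕ) : ℝ) + 1) ^ (-(2 * s)) := fun i =>
    (hlam (i + N) (by omega)).trans (by gcongr; exact le_abs_self c)
  have hτ0 : 0 ≤ ∑' i, lam (i + N) := tsum_nonneg fun i => (h.lam_pos _).le
  have hNn2 : (N : ℝ) / n ^ 2 ≤ (N : ℝ)⁻¹ := by
    rw [inv_eq_one_div, div_le_div_iff₀ (by positivity) hN0]
    nlinarith
  refine ⟨hr0, ?_, ?_, ?_⟩
  · rw [hr]
    nlinarith [mul_le_mul_of_nonneg_left hceil hv.le]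
  · have h1 := hlam' 0
    rw [zero_add] at h1
    calc lam N ≤ |c| * ((N : ℝ) + 1) ^ (-(2 * s)) := h1
      _ ≤ |c| * (N : ℝ) ^ (-(2 * s)) := by
          refine mul_le_mul_of_nonneg_left ?_ (abs_nonneg c)
          exact Real.rpow_le_rpow_of_nonpos hN0 (le_add_of_nonneg_right zero_le_one) (by linarith)
      _ ≤ |c| * r := by gcongr
  -- The weight `N / n ^ 2` is at most `1 / N`. For `2 * s ≤ 1` the trace bound is enough, as `1 / N
  -- ≤ N ^ (-(2 * s))`; otherwise the tail `N ^ (1 - 2 * s) / (2 * s - 1)` supplies the missing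
  -- power.
  · rcases le_or_gt (2 * s) 1 with h2s | h2s
    · calc (N : ℝ) / n ^ 2 * ∑' i, lam (i + N) ≤ (N : ℝ)⁻¹ * κ := by
            gcongr
            exact h.tsum_lam_le N
        _ ≤ (N : ℝ) ^ (-(2 * s)) * κ := by
            gcongr
            rw [← Real.rpow_neg_one]
            exact Real.rpow_le_rpow_of_exponent_le hN1 (by linarith)
        _ ≤ r * κ := by gcongr
        _ ≤ (|c| / |2 * s - 1| + κ) * r := by
            have : 0 ≤ |c| / |2 * s - 1| * r := by positivity
            linarith
    · have h1 := tsum_tail_le_of_rpow h2s (abs_nonneg c) (hNs.trans hNsN)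
        (fun i => (h.lam_pos i).le) hlam'
      have h2 : 0 < 2 * s - 1 := by linarith
      calc (N : ℝ) / n ^ 2 * ∑' i, lam (i + N)
          ≤ (N : ℝ)⁻¹ * (|c| * ((N : ℝ) ^ (1 - 2 * s) / (2 * s - 1))) := by gcongr
        _ = |c| / |2 * s - 1| * (N : ℝ) ^ (-(2 * s)) := by
            rw [abs_of_pos h2, sub_eq_add_neg 1 (2 * s), Real.rpow_one_add' hN0.le (by linarith)]
            field_simp
        _ ≤ |c| / |2 * s - 1| * r := by gcongr
        _ ≤ (|c| / |2 * s - 1| + κ) * r := by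
            gcongr
            linarith

end Rates

end TKRR

end

theorem proposition1 {d : ℕ} (S : Set (TKRR.E d)) (hS : IsCompact S)
    (P : Measure (TKRR.E d)) (hP : IsProbabilityMeasure P) (hPS : P Sᶜ = 0)
    (K : TKRR.E d → TKRR.E d → ℝ) (hK : TKRR.IsMercerKernel S K)
    (hH0 : TKRR.OneToOne P K)
    (lam : ℕ → ℝ) (φ : ℕ → TKRR.E d → ℝ) (hsys : TKRR.IsEigenSystem S P K lam φ)
    (a M : ℝ) (ha : 0 ≤ a)
    (hφ : ∀ k : ℕ, ∀ x ∈ S, |φ k x| ≤ M * ((k : ℝ) + 1) ^ (a / 2))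
    (D : ℝ≥0) (R A c : ℝ) :
    (∃ C : ℝ, 0 < C ∧ ∀ (b : ℝ), 0 < b → ∀ (Nb : ℕ), 1 ≤ Nb →
      (∀ k : ℕ, Nb ≤ k + 1 → lam k ≤ c * Real.exp (-(b * ((k : ℝ) + 1)))) →
      TKRR.RiskBound S P K lam φ D R A (TKRR.expOrder b Nb) (TKRR.expRate b Nb) C) ∧
    (∀ (s : ℝ), a < s → ∃ C : ℝ, 0 < C ∧ ∀ (Ns : ℕ), 1 ≤ Ns →
      (∀ k : ℕ, Ns ≤ k + 1 → lam k ≤ c * ((k : ℝ) + 1) ^ (-(2 * s))) →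
      TKRR.RiskBound S P K lam φ D R A (TKRR.polyOrder s (min 1 (2 - a)) Ns)
        (TKRR.polyRate s (min 1 (2 - a)) Ns) C) := by
  obtain ⟨κ, h⟩ := hsys.exists_isMercerSystem hS hPS hK hH0
  have hκ := h.bound_nonneg
  have hD : (0 : ℝ) ≤ D := D.coe_nonneg
  -- The constants are those of `riskBound_of_le` with `B₁ = 2` and `B₂ = |c|`; `B₃` is the tail
  -- constant of each regime. None involves `b`, `Nb` or `Ns`.
  refine ⟨⟨2 * (|A| + 1) * 2 + 4 * (D * R ^ 2 + D ^ 2 * κ) * |c| +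
    4 * (D * κ) * (|c| + 3 * κ), by positivity, fun b hb Nb hNb hlam => ?_⟩, fun s hs =>
    ⟨2 * (|A| + 1) * 2 + 4 * (D * R ^ 2 + D ^ 2 * κ) * |c| +
    4 * (D * κ) * (|c| / |2 * s - 1| + κ), by positivity, fun Ns hNs hlam => ?_⟩⟩
  · exact TKRR.riskBound_of_le hPS hK h (fun n σ => hNb.trans (le_max_left _ _)) le_rfl
      fun n σ hn hσ hN => h.exp_bounds hb hNb hlam hn hσ hN
  · have hs0 : 0 < s := ha.trans_lt hs
    -- When the minimum is `2 - a`, positivity uses `s > a ≥ 0`.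
    have hq : 0 < 2 * s + min 1 (2 - a) := by
      rcases min_cases 1 (2 - a) with h1 | h1 <;> linarith [h1.1]
    exact TKRR.riskBound_of_le hPS hK h (fun n σ => hNs.trans (le_max_left _ _)) le_rfl
      fun n σ hn hσ hN => h.poly_bounds hs0 hq (min_le_left _ _) hNs hlam hn hσ hN
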